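/- **Setting.** Let $\mathfrak H$ be a separable complex Hilbert space, let $A_0$ be a self-adjoint operator in $\mathfrak H$ and let $B_2$ be a closed operator in $\mathfrak H$ such that the operator $S=A_0\cap B_2$, that is, $Sf=A_0f=B_2f$ on $$\operatorname{dom}(S)=\{f\in\operatorname{dom}(A_0)\cap\operatorname{dom}(B_2)\;:\;A_0f=B_2f\},$$ is densely defined (so $S$ is closed and symmetric, and $B_2$ is densely defined), and such that $S=A_0\cap B_2^*$. Let $\{\mathcal G,\Gamma_0,\Gamma_1\}$ be a boundary triple for $S^*$: $\mathcal G$ is a complex Hilbert space and $\Gamma_0,\Gamma_1:\operatorname{dom}(S^*)\to\mathcal G$ are linear maps such that $(S^*f,g)-(f,S^*g)=(\Gamma_1f,\Gamma_0g)-(\Gamma_0f,\Gamma_1g)$ for all $f,g\in\operatorname{dom}(S^*)$ and $(\Gamma_0,\Gamma_1):\operatorname{dom}(S^*)\to\mathcal G\times\mathcal G$ is onto. Let $\Theta_2$ be a densely defined closed operator in $\mathcal G$, and suppose that $$A_0=S^*\upharpoonright\ker(\Gamma_0),\qquad B_2=S^*\upharpoonright\ker(\Gamma_1-\Theta_2\Gamma_0),$$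 where $\ker(\Gamma_1-\Theta_2\Gamma_0)=\{f\in\operatorname{dom}(S^*):\Gamma_0f\in\operatorname{dom}(\Theta_2),\ \Gamma_1f=\Theta_2\Gamma_0f\}$. Let $M(z)=\Gamma_1\big(\Gamma_0\upharpoonright\ker(S^*-z)\big)^{-1}\in\mathcal B(\mathcal G)$, $z\in\rho(A_0)$, be the corresponding Weyl--Titchmarsh function. For a closed operator $T$, the discrete spectrum $\sigma_d(T)$ is the set of eigenvalues of $T$ that are isolated in $\sigma(T)$ and have finite algebraic multiplicity, in the sense that the Riesz projection $-\frac1{2\pi i}\oint_{C(z;\varepsilon)}(T-\zeta)^{-1}d\zeta$ has finite rank for small $\varepsilon>0$; $m_a(z;T)$ is the dimension of the algebraic eigenspace $\bigcup_n\ker((T-z)^n)$, so that $m_a(z;T)=0$ if $z\in\rho(T)$. A $\mathcal B(\mathcal G)$-valued function $F$ is finitely meromorphic on an open set $\Omega$ if near each $z_1\in\Omega$ one has $F(z)=\sum_{k=1}^{N}(z-z_1)^{-k}F_{-k}+g(z)$ for $z\neq z_1$, with finite rank operators $F_{-k}$ and $g$ analytic at $z_1$. **Statement.** Let $z_0\in\mathbb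 C$ satisfy $$z_0\in\sigma_d(B_2)\cup\rho(B_2)\quad\text{and}\quad z_0\in\sigma_d(A_0)\cup\rho(A_0).$$ Then there exists $\varepsilon_0>0$ such that, with $\Omega=D(z_0;\varepsilon_0)$ the open disc and $\mathcal D_0=\{z_0\}$, the function $F(\cdot)=\Theta_2-M(\cdot)$ on $\Omega\setminus\mathcal D_0$ has densely defined closed operators in $\mathcal G$ as values and satisfies the index hypothesis: 1. $\operatorname{dom}(F(z))$ does not depend on $z\in\Omega\setminus\mathcal D_0$; 2. $F(z)^{-1}\in\mathcal B(\mathcal G)$ for all $z\in\Omega\setminus\mathcal D_0$; 3. $F(\cdot)^{-1}$ is analytic on $\Omega\setminus\mathcal D_0$ and finitely meromorphic on $\Omega$; 4. $z\mapsto F(z)\varphi$ is analytic on $\Omega\setminus\mathcal D_0$ for every $\varphi$ in the common domain; 5. for $z\in\Omega\setminus\mathcal D_0$ the operator $F'(z):\varphi\mapsto\frac{d}{dz}F(z)\varphi$ on the common domain extends to a bounded operator $\overline{F'(z)}\in\mathcal B(\mathcal G)$, and $\overline{F'(\cdot)}$ is analytic on $\Omega\setminus\mathcal D_0$ and finitely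 meromorphic on $\Omega$. Moreover, for all $0<\varepsilon<\varepsilon_0$ the operator $\frac1{2\pi i}\oint_{C(z_0;\varepsilon)}\overline{F'(\zeta)}F(\zeta)^{-1}d\zeta$ has finite rank, and its trace, the generalized index $\widetilde{\operatorname{ind}}_{C(z_0;\varepsilon)}(\Theta_2-M(\cdot))$, satisfies $$\widetilde{\operatorname{ind}}_{C(z_0;\varepsilon)}\big(\Theta_2-M(\cdot)\big)=m_a(z_0;B_2)-m_a(z_0;A_0).$$ -/

import Mathlib

noncomputable section

namespace GenIndex

open Filter Topology

section Operators

variable {E : Type*} [NormedAddCommGroup E] [InnerProductSpace ℂ E]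

/-- The operator `T - z I`, with domain `dom T`. -/
def subScalar (T : E →ₗ.[ℂ] E) (z : ℂ) : E →ₗ.[ℂ] E :=
  ⟨T.domain, T.toFun - z • T.domain.subtype⟩

/-- `R` is the everywhere defined, bounded inverse of the operator `A : dom A → E`:
`A x = y` (with `x ∈ dom A`) if and only if `x = R y`. -/
def IsBoundedInverse (A : E →ₗ.[ℂ] E) (R : E →L[ℂ] E) : Prop :=
  ∀ x y : E, (x, y) ∈ A.graph ↔ R y = x

/-- `A` is boundedly invertible: `A⁻¹ ∈ 𝓑(E)`. -/
def BoundedlyInvertible (A : E →ₗ.[ℂ] E) : Prop :=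
  ∃ R : E →L[ℂ] E, IsBoundedInverse A R

open scoped Classical in
/-- The bounded operator `A⁻¹` (and `0` if `A` is not boundedly invertible). -/
def boundedInverse (A : E →ₗ.[ℂ] E) : E →L[ℂ] E :=
  if h : BoundedlyInvertible A then h.choose else 0

/-- The resolvent set `ρ(T)`. -/
def resolventSet (T : E →ₗ.[ℂ] E) : Set ℂ :=
  {z | BoundedlyInvertible (subScalar T z)}

/-- The bounded operator `T` has finite rank. -/
def FiniteRank (T : E →L[ℂ] E) : Prop :=
  FiniteDimensional ℂ (LinearMap.range T.toLinearMap)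

/-- The trace of a finite rank operator `T`, i.e. the trace of the endomorphism that `T` induces on
its (finite-dimensional) range. -/
def finiteRankTrace (T : E →L[ℂ] E) : ℂ :=
  LinearMap.trace ℂ (LinearMap.range T.toLinearMap)
    (T.toLinearMap.restrict fun x _ => LinearMap.mem_range_self T.toLinearMap x)

/-- The Riesz projection `-(2πi)⁻¹ ∮_{C(z₀;ε)} (T - ζ)⁻¹ dζ`. -/
def rieszProjection (T : E →ₗ.[ℂ] E) (z₀ : ℂ) (ε : ℝ) : E →L[ℂ] E :=
  -((2 * Real.pi * Complex.I : ℂ)⁻¹ • ∮ ζ in C(z₀, ε), boundedInverse (subScalar T ζ))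

/-- `ker (T - z)ⁿ`, where `(T - z)ⁿ` has its natural domain. -/
def kerPow (T : E →ₗ.[ℂ] E) (z : ℂ) : ℕ → Submodule ℂ E
  | 0 => ⊥
  | n + 1 => ((kerPow T z n).comap (subScalar T z).toFun).map (subScalar T z).domain.subtype

/-- The algebraic eigenspace `⋃ₙ ker (T - z)ⁿ`. -/
def algebraicEigenspace (T : E →ₗ.[ℂ] E) (z : ℂ) : Submodule ℂ E :=
  ⨆ n, kerPow T z n

/-- The algebraic multiplicity `m_a(z; T)`, the dimension of the algebraic eigenspace;
it is `0` if `z ∈ ρ(T)`. -/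
def algMult (T : E →ₗ.[ℂ] E) (z : ℂ) : ℕ :=
  Module.finrank ℂ (algebraicEigenspace T z)

/-- The discrete spectrum `σ_d(T)`: the eigenvalues of `T` that are isolated in the spectrum and
have finite algebraic multiplicity. As usual for operators that need not be normal, finiteness of
the multiplicity of an isolated point of the spectrum means that the Riesz projection has finite
rank (its range is then the algebraic eigenspace). -/
def discreteSpectrum (T : E →ₗ.[ℂ] E) : Set ℂ :=
  {z | (∃ x : T.domain, (x : E) ≠ 0 ∧ T x = z • (x : E)) ∧
    ∃ ε > 0, (∀ ζ, ζ ≠ z → dist ζ z < ε → ζ ∈ resolventSet T) ∧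
      ∀ r, 0 < r → r < ε → FiniteRank (rieszProjection T z r)}

end Operators

section Index

variable {G : Type*} [NormedAddCommGroup G] [InnerProductSpace ℂ G]

/-- `F` is finitely meromorphic at `z₀`: near `z₀` it is the sum of an analytic function and of a
principal part with finitely many terms, all of whose coefficients have finite rank. -/
def FinitelyMeromorphicAt (F : ℂ → G →L[ℂ] G) (z₀ : ℂ) : Prop :=
  ∃ (N : ℕ) (c : ℕ → G →L[ℂ] G) (g : ℂ → G →L[ℂ] G),
    (∀ k < N, FiniteRank (c k)) ∧ AnalyticAt ℂ g z₀ ∧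
      ∀ᶠ z in 𝓝[≠] z₀, F z = ∑ k ∈ Finset.range N, ((z - z₀) ^ (k + 1))⁻¹ • c k + g z

/-- `F` is finitely meromorphic on `Ω` (at a point that is not a pole there is no principal
part, and the condition says that the singularity is removable). -/
def FinitelyMeromorphicOn (F : ℂ → G →L[ℂ] G) (Ω : Set ℂ) : Prop :=
  ∀ z ∈ Ω, FinitelyMeromorphicAt F z

open scoped Classical in
/-- The value `A x` for `x ∈ dom A` (and `0` otherwise). -/
def value (A : G →ₗ.[ℂ] G) (x : G) : G :=
  if h : x ∈ A.domain then A ⟨x, h⟩ else 0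

/-- `D` is a bounded continuation of the operator `M'(z)`, `φ ↦ (d/dz) M(z) φ`, that is defined
on `dom (M z)`. -/
def IsDerivClosure (M : ℂ → G →ₗ.[ℂ] G) (z : ℂ) (D : G →L[ℂ] G) : Prop :=
  ∀ φ ∈ (M z).domain, D φ = deriv (fun w => value (M w) φ) z

open scoped Classical in
/-- The bounded operator obtained from `M'(z)` by continuation (unique if `dom (M z)` is dense;
`0` if there is none). -/
def derivClosure (M : ℂ → G →ₗ.[ℂ] G) (z : ℂ) : G →L[ℂ] G :=
  if h : ∃ D, IsDerivClosure M z D then h.choose else 0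

/-- The assumptions under which the generalized index of an operator-valued function
`M : Ω \ D₀ → 𝓒(G)` is defined. -/
structure IndexHypothesis (Ω D₀ : Set ℂ) (M : ℂ → G →ₗ.[ℂ] G) : Prop where
  isOpen : IsOpen Ω
  isConnected : IsConnected Ω
  subset : D₀ ⊆ Ω
  /-- `D₀` has no limit points in `Ω` -/
  discrete : ∀ z ∈ Ω, ¬ AccPt z (𝓟 D₀)
  /-- the values of `M` are closed and densely defined -/
  closed : ∀ z ∈ Ω \ D₀, (M z).IsClosed
  dense : ∀ z ∈ Ω \ D₀, Dense ((M z).domain : Set G)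
  /-- (i) -/
  domain_eq : ∀ z ∈ Ω \ D₀, ∀ w ∈ Ω \ D₀, (M z).domain = (M w).domain
  /-- (ii) -/
  invertible : ∀ z ∈ Ω \ D₀, BoundedlyInvertible (M z)
  /-- (iii) -/
  inv_analytic : AnalyticOnNhd ℂ (fun z => boundedInverse (M z)) (Ω \ D₀)
  inv_finMero : FinitelyMeromorphicOn (fun z => boundedInverse (M z)) Ω
  /-- (iv) -/
  analytic : ∀ φ, (∀ z ∈ Ω \ D₀, φ ∈ (M z).domain) →
    AnalyticOnNhd ℂ (fun z => value (M z) φ) (Ω \ D₀)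
  /-- (v) -/
  deriv_bounded : ∀ z ∈ Ω \ D₀, ∃ D, IsDerivClosure M z D
  deriv_analytic : AnalyticOnNhd ℂ (derivClosure M) (Ω \ D₀)
  deriv_finMero : FinitelyMeromorphicOn (derivClosure M) Ω

/-- The operator `(2πi)⁻¹ ∮_{C(z₀;ε)} M'(ζ) M(ζ)⁻¹ dζ`, with `M'(ζ)` extended by continuity. -/
def indexOperator (M : ℂ → G →ₗ.[ℂ] G) (z₀ : ℂ) (ε : ℝ) : G →L[ℂ] G :=
  (2 * Real.pi * Complex.I : ℂ)⁻¹ •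
    ∮ ζ in C(z₀, ε), derivClosure M ζ ∘L boundedInverse (M ζ)

/-- The generalized index of `M` with respect to the circle `C(z₀;ε)`. -/
def generalizedIndex (M : ℂ → G →ₗ.[ℂ] G) (z₀ : ℂ) (ε : ℝ) : ℂ :=
  finiteRankTrace (indexOperator M z₀ ε)

end Index

section BoundaryTriples

variable {H : Type*} [NormedAddCommGroup H] [InnerProductSpace ℂ H]
variable {G : Type*} [NormedAddCommGroup G] [InnerProductSpace ℂ G]

/-- The restriction of `T` to a subspace of its domain. -/
def restrictTo (T : H →ₗ.[ℂ] H) (L : Submodule ℂ T.domain) : H →ₗ.[ℂ] H :=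
  T.domRestrict (L.map T.domain.subtype)

/-- A boundary triple `{G, Γ₀, Γ₁}` for the operator `T` (which is `S*` in the applications):
the abstract Green identity holds and `(Γ₀, Γ₁) : dom T → G × G` is onto. The inner product of
Mathlib is linear in the second entry, hence the order of the arguments. -/
structure BoundaryTriple (T : H →ₗ.[ℂ] H) (G : Type*) [NormedAddCommGroup G]
    [InnerProductSpace ℂ G] where
  Γ₀ : T.domain →ₗ[ℂ] G
  Γ₁ : T.domain →ₗ[ℂ] G
  green : ∀ f g : T.domain,
    inner ℂ (g : H) (T f) - inner ℂ (T g) (f : H) =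
      inner ℂ (Γ₀ g) (Γ₁ f) - inner ℂ (Γ₁ g) (Γ₀ f)
  surjective : Function.Surjective (Γ₀.prod Γ₁)

namespace BoundaryTriple

variable {T : H →ₗ.[ℂ] H}

/-- The extension `T ↾ ker Γ₀`. -/
def extZero (b : BoundaryTriple T G) : H →ₗ.[ℂ] H :=
  restrictTo T (LinearMap.ker b.Γ₀)

/-- The extension `T ↾ ker (Γ₁ - Θ Γ₀)`, that is, the restriction of `T` to all `f ∈ dom T` such
that `Γ₀ f ∈ dom Θ` and `Γ₁ f = Θ Γ₀ f`. -/
def ext (b : BoundaryTriple T G) (Θ : G →ₗ.[ℂ] G) : H →ₗ.[ℂ] H :=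
  restrictTo T (Θ.graph.comap (b.Γ₀.prod b.Γ₁))

/-- The Weyl--Titchmarsh function `M(z) = Γ₁ (Γ₀ ↾ ker (T - z))⁻¹`: the operator with graph
`{(Γ₀ f, Γ₁ f) | f ∈ ker (T - z)}`. -/
def weyl (b : BoundaryTriple T G) (z : ℂ) : G →ₗ.[ℂ] G :=
  ((LinearMap.ker (T.toFun - z • T.domain.subtype)).map (b.Γ₀.prod b.Γ₁)).toLinearPMap

end BoundaryTriple

end BoundaryTriples

end GenIndex

end

/-!
Writing `γ(z) = (Γ₀ ↾ ker (S* - z))⁻¹`, one has `M'(z) = Γ₁ (A₀ - z)⁻¹ γ(z)` and Krein's formula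
`(B₂ - z)⁻¹ - (A₀ - z)⁻¹ = γ(z) (Θ₂ - M(z))⁻¹ Γ₁ (A₀ - z)⁻¹`.
Thus the integrand of the index is `-a c` with `a = Γ₁ (A₀ - z)⁻¹` and `c = γ(z) (Θ₂ - M(z))⁻¹`,
while `c a` is the difference of the resolvents. All the operator functions involved depend on `z`
through `(A₀ - z)⁻¹` and `(B₂ - z)⁻¹` only, hence are finitely meromorphic at `z₀`, and the residues
of `a c` and `c a` have the same trace. Finally, the residue of a resolvent is minus the Riesz
projection, whose trace is the algebraic multiplicity.
-/

noncomputable section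

namespace GenIndex

open Filter Topology

/-! ### Finite rank operators and their traces -/

section FiniteRank

variable {E F K : Type*} [NormedAddCommGroup E] [NormedSpace ℂ E]
  [NormedAddCommGroup F] [NormedSpace ℂ F] [NormedAddCommGroup K] [NormedSpace ℂ K]

/-- Finite rank for bounded operators between two spaces; for endomorphisms of a Hilbert space it
is `FiniteRank`. -/
def HasFiniteRank (T : E →L[ℂ] F) : Prop :=
  FiniteDimensional ℂ (LinearMap.range T.toLinearMap)

theorem HasFiniteRank.of_forall_mem {T : E →L[ℂ] F} (V : Submodule ℂ F) [FiniteDimensional ℂ V]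
    (h : ∀ x, T x ∈ V) : HasFiniteRank T :=
  Submodule.finiteDimensional_of_le (LinearMap.range_le_iff_comap.2 <|
    Submodule.eq_top_iff'.2 h : LinearMap.range T.toLinearMap ≤ V)

theorem hasFiniteRank_zero : HasFiniteRank (0 : E →L[ℂ] F) :=
  .of_forall_mem ⊥ (by simp)

theorem HasFiniteRank.add {S T : E →L[ℂ] F} (hS : HasFiniteRank S) (hT : HasFiniteRank T) :
    HasFiniteRank (S + T) := by
  rw [HasFiniteRank] at hS hT
  exact .of_forall_mem (LinearMap.range S.toLinearMap ⊔ LinearMap.range T.toLinearMap)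
    fun x => Submodule.add_mem_sup ⟨x, rfl⟩ ⟨x, rfl⟩

theorem HasFiniteRank.comp_right {T : F →L[ℂ] K} (hT : HasFiniteRank T) (S : E →L[ℂ] F) :
    HasFiniteRank (T ∘L S) := by
  rw [HasFiniteRank] at hT
  exact .of_forall_mem (LinearMap.range T.toLinearMap) fun x => ⟨S x, rfl⟩

theorem HasFiniteRank.comp_left {T : E →L[ℂ] F} (hT : HasFiniteRank T) (S : F →L[ℂ] K) :
    HasFiniteRank (S ∘L T) := by
  rw [HasFiniteRank] at hT
  exact .of_forall_mem ((LinearMap.range T.toLinearMap).map S.toLinearMap)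
    fun x => ⟨T x, ⟨x, rfl⟩, rfl⟩

theorem HasFiniteRank.neg {T : E →L[ℂ] F} (hT : HasFiniteRank T) : HasFiniteRank (-T) := by
  simpa using hT.comp_left (-ContinuousLinearMap.id ℂ F)

end FiniteRank

section Trace

variable {E F : Type*} [NormedAddCommGroup E] [InnerProductSpace ℂ E]
  [NormedAddCommGroup F] [InnerProductSpace ℂ F]

theorem finiteRankTrace_eq_trace_restrict (T : E →L[ℂ] E) (V : Submodule ℂ E)
    [FiniteDimensional ℂ V] (h : ∀ x, T x ∈ V) :
    finiteRankTrace T = LinearMap.trace ℂ V (T.toLinearMap.restrict fun x _ => h x) := by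
  have : FiniteDimensional ℂ (LinearMap.range T.toLinearMap) := HasFiniteRank.of_forall_mem V h
  let f : LinearMap.range T.toLinearMap →ₗ[ℂ] V :=
    Submodule.inclusion (LinearMap.range_le_iff_comap.2 (Submodule.eq_top_iff'.2 h))
  let g : V →ₗ[ℂ] LinearMap.range T.toLinearMap := T.toLinearMap.rangeRestrict ∘ₗ V.subtype
  exact LinearMap.trace_comp_comm' f g

theorem finiteRankTrace_add {S T : E →L[ℂ] E} (hS : HasFiniteRank S) (hT : HasFiniteRank T) :
    finiteRankTrace (S + T) = finiteRankTrace S + finiteRankTrace T := by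
  rw [HasFiniteRank] at hS hT
  let V := LinearMap.range S.toLinearMap ⊔ LinearMap.range T.toLinearMap
  have hSV : ∀ x, S x ∈ V := fun x => Submodule.mem_sup_left ⟨x, rfl⟩
  have hTV : ∀ x, T x ∈ V := fun x => Submodule.mem_sup_right ⟨x, rfl⟩
  rw [finiteRankTrace_eq_trace_restrict S V hSV, finiteRankTrace_eq_trace_restrict T V hTV,
    finiteRankTrace_eq_trace_restrict (S + T) V fun x => V.add_mem (hSV x) (hTV x), ← map_add]
  rfl

theorem finiteRankTrace_zero : finiteRankTrace (0 : E →L[ℂ] E) = 0 := by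
  simpa using finiteRankTrace_add (hasFiniteRank_zero (E := E) (F := E)) hasFiniteRank_zero

theorem finiteRankTrace_neg {T : E →L[ℂ] E} (hT : HasFiniteRank T) :
    finiteRankTrace (-T) = -finiteRankTrace T := by
  have h := finiteRankTrace_add hT hT.neg
  rw [add_neg_cancel, finiteRankTrace_zero] at h
  exact (neg_eq_of_add_eq_zero_right h.symm).symm

theorem finiteRankTrace_comp_comm {S : E →L[ℂ] F} (hS : HasFiniteRank S) (T : F →L[ℂ] E) :
    finiteRankTrace (S ∘L T) = finiteRankTrace (T ∘L S) := by
  rw [HasFiniteRank] at hS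
  let V := LinearMap.range S.toLinearMap
  let W := V.map T.toLinearMap
  rw [finiteRankTrace_eq_trace_restrict (S ∘L T) V fun x => ⟨T x, rfl⟩,
    finiteRankTrace_eq_trace_restrict (T ∘L S) W fun x => ⟨S x, ⟨x, rfl⟩, rfl⟩]
  let f : W →ₗ[ℂ] V := S.toLinearMap.rangeRestrict ∘ₗ W.subtype
  let g : V →ₗ[ℂ] W := (T.toLinearMap ∘ₗ V.subtype).codRestrict W fun x => ⟨x, x.2, rfl⟩
  exact LinearMap.trace_comp_comm' g f

theorem finiteRankTrace_of_isIdempotentElem {P : E →L[ℂ] E} (hP : HasFiniteRank P)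
    (h : IsIdempotentElem P) :
    finiteRankTrace P = (Module.finrank ℂ (LinearMap.range P.toLinearMap) : ℂ) := by
  rw [HasFiniteRank] at hP
  have hid : P.toLinearMap.restrict (fun x _ => LinearMap.mem_range_self P.toLinearMap x) =
      (LinearMap.id : LinearMap.range P.toLinearMap →ₗ[ℂ] _) := by
    ext ⟨_, x, rfl⟩
    exact congr($h x)
  rw [finiteRankTrace, hid, LinearMap.trace_id]

end Trace

/-! ### Residues of operator-valued functions -/

section Residues

variable {E F : Type*} [NormedAddCommGroup E] [NormedSpace ℂ E]
  [NormedAddCommGroup F] [NormedSpace ℂ F] {z₀ : ℂ} {r : ℝ}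

/-- The normalized integral `(2πi)⁻¹ ∮_{C(z₀;r)} f(ζ) dζ`, the residue of `f` at an isolated
singularity `z₀` when `r` is small. -/
def residueIntegral (f : ℂ → E) (z₀ : ℂ) (r : ℝ) : E :=
  (2 * Real.pi * Complex.I : ℂ)⁻¹ • ∮ ζ in C(z₀, r), f ζ

theorem residueIntegral_congr {f g : ℂ → E} (hr : 0 ≤ r)
    (h : Set.EqOn f g (Metric.sphere z₀ r)) :
    residueIntegral f z₀ r = residueIntegral g z₀ r := by
  rw [residueIntegral, residueIntegral, circleIntegral.integral_congr hr h]

theorem residueIntegral_add {f g : ℂ → E} (hf : CircleIntegrable f z₀ r)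
    (hg : CircleIntegrable g z₀ r) :
    residueIntegral (fun z => f z + g z) z₀ r =
      residueIntegral f z₀ r + residueIntegral g z₀ r := by
  rw [residueIntegral, circleIntegral.integral_add hf hg, smul_add, residueIntegral,
    residueIntegral]

theorem residueIntegral_sub {f g : ℂ → E} (hf : CircleIntegrable f z₀ r)
    (hg : CircleIntegrable g z₀ r) :
    residueIntegral (fun z => f z - g z) z₀ r =
      residueIntegral f z₀ r - residueIntegral g z₀ r := by
  rw [residueIntegral, circleIntegral.integral_sub hf hg, smul_sub, residueIntegral,
    residueIntegral]

theorem residueIntegral_neg (f : ℂ → E) :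
    residueIntegral (fun z => -f z) z₀ r = -residueIntegral f z₀ r := by
  simpa [residueIntegral] using
    congr((2 * Real.pi * Complex.I : ℂ)⁻¹ • $(circleIntegral.integral_smul (-1 : ℂ) f z₀ r))

theorem residueIntegral_clm_apply [CompleteSpace E] [CompleteSpace F] (L : E →L[ℂ] F) {f : ℂ → E}
    (hf : CircleIntegrable f z₀ r) :
    residueIntegral (fun z => L (f z)) z₀ r = L (residueIntegral f z₀ r) := by
  simp only [residueIntegral, circleIntegral, map_smul,
    ← ContinuousLinearMap.intervalIntegral_comp_comm L hf.out]

theorem residueIntegral_comp_left {K : Type*} [NormedAddCommGroup K] [NormedSpace ℂ K]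
    [CompleteSpace F] [CompleteSpace K] (A : F →L[ℂ] K) {f : ℂ → E →L[ℂ] F}
    (hf : CircleIntegrable f z₀ r) :
    residueIntegral (fun z => A ∘L f z) z₀ r = A ∘L residueIntegral f z₀ r :=
  residueIntegral_clm_apply (ContinuousLinearMap.compL ℂ E F K A) hf

theorem residueIntegral_comp_right {K : Type*} [NormedAddCommGroup K] [NormedSpace ℂ K]
    [CompleteSpace K] (A : E →L[ℂ] F) {f : ℂ → F →L[ℂ] K} (hf : CircleIntegrable f z₀ r) :
    residueIntegral (fun z => f z ∘L A) z₀ r = residueIntegral f z₀ r ∘L A :=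
  residueIntegral_clm_apply ((ContinuousLinearMap.compL ℂ E F K).flip A) hf

theorem residueIntegral_eq_zero {f : ℂ → E} (hr : 0 ≤ r)
    (hf : DifferentiableOn ℂ f (Metric.closedBall z₀ r)) : residueIntegral f z₀ r = 0 := by
  rw [residueIntegral, (hf.diffContOnCl_ball subset_rfl).circleIntegral_eq_zero hr, smul_zero]

theorem residueIntegral_sub_inv_smul [CompleteSpace E] {w : ℂ} (hw : w ∈ Metric.ball z₀ r)
    (a : E) : residueIntegral (fun z => (z - w)⁻¹ • a) z₀ r = a := by
  rw [residueIntegral, circleIntegral.integral_smul_const,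
    circleIntegral.integral_sub_inv_of_mem_ball hw, smul_smul,
    inv_mul_cancel₀ Complex.two_pi_I_ne_zero, one_smul]

theorem residueIntegral_eq_of_differentiableOn {f : ℂ → E} {ε s : ℝ}
    (hf : DifferentiableOn ℂ f (Metric.ball z₀ ε \ {z₀})) (hr : r ∈ Set.Ioo 0 ε)
    (hs : s ∈ Set.Ioo 0 ε) : residueIntegral f z₀ r = residueIntegral f z₀ s := by
  wlog h : r ≤ s generalizing r s
  · exact (this hs hr (le_of_not_ge h)).symm
  have hsub : Metric.closedBall z₀ s \ Metric.ball z₀ r ⊆ Metric.ball z₀ ε \ {z₀} :=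
    Set.sdiff_subset_sdiff (Metric.closedBall_subset_ball hs.2)
      (Set.singleton_subset_iff.2 (Metric.mem_ball_self hr.1))
  have hdiff : ∀ z ∈ Metric.closedBall z₀ s \ Metric.ball z₀ r, DifferentiableAt ℂ f z :=
    fun z hz => hf.differentiableAt
      ((Metric.isOpen_ball.sdiff isClosed_singleton).mem_nhds (hsub hz))
  rw [residueIntegral, residueIntegral,
    Complex.circleIntegral_eq_of_differentiable_on_annulus_off_countable hr.1 h
      Set.countable_empty (hf.continuousOn.mono hsub)
      fun z hz => hdiff z ⟨Metric.ball_subset_closedBall hz.1.1,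
        fun hz' => hz.1.2 (Metric.ball_subset_closedBall hz')⟩]

end Residues

/-! ### Finitely meromorphic functions -/

section FinitelyMeromorphic

variable {E F K : Type*} [NormedAddCommGroup E] [NormedSpace ℂ E]
  [NormedAddCommGroup F] [NormedSpace ℂ F] [NormedAddCommGroup K] [NormedSpace ℂ K] {z₀ : ℂ}

/-- `FinitelyMeromorphicAt` for functions whose values are bounded operators between two spaces. -/
def IsFinMeroAt (f : ℂ → E →L[ℂ] F) (z₀ : ℂ) : Prop :=
  ∃ (N : ℕ) (c : ℕ → E →L[ℂ] F) (g : ℂ → E →L[ℂ] F),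
    (∀ k < N, HasFiniteRank (c k)) ∧ AnalyticAt ℂ g z₀ ∧
      ∀ᶠ z in 𝓝[≠] z₀, f z = ∑ k ∈ Finset.range N, ((z - z₀) ^ (k + 1))⁻¹ • c k + g z

theorem IsFinMeroAt.congr {f g : ℂ → E →L[ℂ] F} (hf : IsFinMeroAt f z₀) (h : f =ᶠ[𝓝[≠] z₀] g) :
    IsFinMeroAt g z₀ := by
  obtain ⟨N, c, k, hc, hk, hf⟩ := hf
  exact ⟨N, c, k, hc, hk, h.symm.trans hf⟩

theorem isFinMeroAt_of_analyticAt {f : ℂ → E →L[ℂ] F} (hf : AnalyticAt ℂ f z₀) :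
    IsFinMeroAt f z₀ :=
  ⟨0, 0, f, by simp, hf, by simp⟩

theorem IsFinMeroAt.add {f g : ℂ → E →L[ℂ] F} (hf : IsFinMeroAt f z₀) (hg : IsFinMeroAt g z₀) :
    IsFinMeroAt (f + g) z₀ := by
  obtain ⟨N, c, k, hc, hk, hf⟩ := hf
  obtain ⟨N', c', k', hc', hk', hg⟩ := hg
  have truncate (c : ℕ → E →L[ℂ] F) {N M : ℕ} (hNM : N ≤ M) (z : ℂ) :
      ∑ i ∈ Finset.range M, ((z - z₀) ^ (i + 1))⁻¹ • (if i < N then c i else 0) =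
        ∑ i ∈ Finset.range N, ((z - z₀) ^ (i + 1))⁻¹ • c i := by
    simp_rw [smul_ite, smul_zero, ← Finset.sum_filter]
    congr 1
    ext i
    simpa using fun h => h.trans_le hNM
  refine ⟨max N N', fun i => (if i < N then c i else 0) + (if i < N' then c' i else 0), k + k',
    fun i _ => .add ?_ ?_, hk.add hk', ?_⟩
  · split_ifs with h
    exacts [hc i h, hasFiniteRank_zero]
  · split_ifs with h
    exacts [hc' i h, hasFiniteRank_zero]
  · filter_upwards [hf, hg] with z hfz hgz
    simp only [smul_add, Finset.sum_add_distrib, truncate c (le_max_left N N'),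
      truncate c' (le_max_right N N'), Pi.add_apply, hfz, hgz]
    abel

theorem HasFiniteRank.isFinMeroAt_inv_pow_smul {A : E →L[ℂ] F} (hA : HasFiniteRank A) (k : ℕ) :
    IsFinMeroAt (fun z => ((z - z₀) ^ k)⁻¹ • A) z₀ := by
  cases k with
  | zero => simpa using isFinMeroAt_of_analyticAt analyticAt_const
  | succ k =>
    refine ⟨k + 1, fun i => if i = k then A else 0, 0, fun i _ => ?_, analyticAt_const, ?_⟩
    · dsimp only
      split_ifs
      exacts [hA, hasFiniteRank_zero]
    · exact Eventually.of_forall fun z => by simp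

@[elab_as_elim]
theorem IsFinMeroAt.induction_on {motive : (ℂ → E →L[ℂ] F) → Prop} {f : ℂ → E →L[ℂ] F}
    (hf : IsFinMeroAt f z₀) (analytic : ∀ g, AnalyticAt ℂ g z₀ → motive g)
    (pole : ∀ (A : E →L[ℂ] F) (k : ℕ), HasFiniteRank A →
      motive fun z => ((z - z₀) ^ (k + 1))⁻¹ • A)
    (add : ∀ g h, IsFinMeroAt g z₀ → IsFinMeroAt h z₀ → motive g → motive h → motive (g + h))
    (congr : ∀ g h, g =ᶠ[𝓝[≠] z₀] h → motive g → motive h) : motive f := by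
  obtain ⟨N, c, g, hc, hg, hf⟩ := hf
  have principal (n : ℕ) (hn : n ≤ N) :
      IsFinMeroAt (fun z => ∑ k ∈ Finset.range n, ((z - z₀) ^ (k + 1))⁻¹ • c k) z₀ ∧
        motive fun z => ∑ k ∈ Finset.range n, ((z - z₀) ^ (k + 1))⁻¹ • c k := by
    induction n with
    | zero =>
      simpa using And.intro (isFinMeroAt_of_analyticAt analyticAt_const)
        (analytic _ (analyticAt_const (v := (0 : E →L[ℂ] F))))
    | succ n ih =>
      obtain ⟨hmero, hmotive⟩ := ih (Nat.le_of_succ_le hn)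
      have hpole := (hc n hn).isFinMeroAt_inv_pow_smul (z₀ := z₀) (n + 1)
      simp_rw [Finset.sum_range_succ]
      exact ⟨hmero.add hpole, add _ _ hmero hpole hmotive (pole _ n (hc n hn))⟩
  obtain ⟨hmero, hmotive⟩ := principal N le_rfl
  exact congr _ f (EventuallyEq.symm hf)
    (add _ g hmero (isFinMeroAt_of_analyticAt hg) hmotive (analytic g hg))

theorem IsFinMeroAt.meromorphicAt {f : ℂ → E →L[ℂ] F} (hf : IsFinMeroAt f z₀) :
    MeromorphicAt f z₀ := by
  refine hf.induction_on (fun g hg => hg.meromorphicAt) (fun A k _ => by fun_prop)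
    (fun g h _ _ hg hh => hg.add hh) fun g h hgh hg => hg.congr hgh

/-- The expansion of `h` at `z₀` lowers the order of the pole of `(z - z₀)⁻ᵏ L (h z)`, with
coefficients in the range of `L`. -/
theorem isFinMeroAt_inv_pow_smul_of_analyticAt {X : Type*} [NormedAddCommGroup X]
    [NormedSpace ℂ X] (L : X →L[ℂ] E →L[ℂ] F) (hL : ∀ x, HasFiniteRank (L x))
    (k : ℕ) {h : ℂ → X} (hh : AnalyticAt ℂ h z₀) :
    IsFinMeroAt (fun z => ((z - z₀) ^ k)⁻¹ • L (h z)) z₀ := by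
  induction k generalizing h with
  | zero =>
    simpa [Function.comp_def] using isFinMeroAt_of_analyticAt ((L.analyticAt (h z₀)).comp hh)
  | succ k ih =>
    obtain ⟨p, hp⟩ := hh
    have hd : AnalyticAt ℂ (dslope h z₀) z₀ := hp.has_fpower_series_dslope_fslope.analyticAt
    refine (((hL (h z₀)).isFinMeroAt_inv_pow_smul (k + 1)).add (ih hd)).congr ?_
    filter_upwards [self_mem_nhdsWithin] with z hz
    have hz' : z - z₀ ≠ 0 := sub_ne_zero.2 hz
    have hexp : h z = h z₀ + (z - z₀) • dslope h z₀ z := by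
      rw [sub_smul_dslope, add_sub_cancel]
    rw [Pi.add_apply, hexp, map_add, smul_add, map_smul, smul_smul, pow_succ, mul_inv,
      inv_mul_cancel_right₀ hz']

theorem analyticAt_clm_comp {f : ℂ → F →L[ℂ] K} {g : ℂ → E →L[ℂ] F} {z : ℂ}
    (hf : AnalyticAt ℂ f z) (hg : AnalyticAt ℂ g z) : AnalyticAt ℂ (fun z => f z ∘L g z) z :=
  ((ContinuousLinearMap.compL ℂ E F K).analyticAt_bilinear (f z, g z)).comp₂ hf hg

theorem IsFinMeroAt.comp {f : ℂ → F →L[ℂ] K} {g : ℂ → E →L[ℂ] F} (hf : IsFinMeroAt f z₀)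
    (hg : IsFinMeroAt g z₀) : IsFinMeroAt (fun z => f z ∘L g z) z₀ := by
  refine hf.induction_on (fun f hf => ?_) (fun A k hA => ?_) (fun f₁ f₂ _ _ h₁ h₂ => ?_)
    fun f₁ f₂ h h₁ => h₁.congr (h.mono fun z hz => by simp only [hz])
  · refine hg.induction_on (fun g hg => isFinMeroAt_of_analyticAt (analyticAt_clm_comp hf hg))
      (fun A k hA => ?_) (fun g₁ g₂ _ _ h₁ h₂ => ?_)
      fun g₁ g₂ h h₁ => h₁.congr (h.mono fun z hz => by simp only [hz])
    · simpa using isFinMeroAt_inv_pow_smul_of_analyticAt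
        ((ContinuousLinearMap.compL ℂ E F K).flip A) hA.comp_left (k + 1) hf
    · simpa [Pi.add_def] using h₁.add h₂
  · refine hg.induction_on (fun g hg => ?_) (fun B l _ => ?_) (fun g₁ g₂ _ _ h₁ h₂ => ?_)
      fun g₁ g₂ h h₁ => h₁.congr (h.mono fun z hz => by simp only [hz])
    · simpa using isFinMeroAt_inv_pow_smul_of_analyticAt
        (ContinuousLinearMap.compL ℂ E F K A) hA.comp_right (k + 1) hg
    · simpa [pow_add, smul_smul, mul_comm, mul_assoc, mul_left_comm] using
        (hA.comp_right B).isFinMeroAt_inv_pow_smul (z₀ := z₀) (k + 1 + (l + 1))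
    · simpa [Pi.add_def] using h₁.add h₂
  · simpa [Pi.add_def, ContinuousLinearMap.add_comp] using h₁.add h₂

theorem IsFinMeroAt.neg {f : ℂ → E →L[ℂ] F} (hf : IsFinMeroAt f z₀) :
    IsFinMeroAt (fun z => -f z) z₀ := by
  simpa using (isFinMeroAt_of_analyticAt
    (analyticAt_const (v := -ContinuousLinearMap.id ℂ F))).comp hf

theorem analyticAt_id_add_smul {f : ℂ → E →L[ℂ] E} {z : ℂ} (w : ℂ) (hf : AnalyticAt ℂ f z) :
    AnalyticAt ℂ (fun ζ => .id ℂ E + (ζ - w) • f ζ) z :=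
  analyticAt_const.add ((analyticAt_id.sub analyticAt_const).smul hf)

theorem IsFinMeroAt.id_add_smul {f : ℂ → E →L[ℂ] E} (hf : IsFinMeroAt f z₀) (w : ℂ) :
    IsFinMeroAt (fun ζ => .id ℂ E + (ζ - w) • f ζ) z₀ := by
  have hscalar : AnalyticAt ℂ (fun ζ => (ζ - w) • ContinuousLinearMap.id ℂ E) z₀ :=
    (analyticAt_id.sub analyticAt_const).smul analyticAt_const
  exact (isFinMeroAt_of_analyticAt analyticAt_const).add
    ((isFinMeroAt_of_analyticAt hscalar).comp hf)

theorem finitelyMeromorphicOn_of_analyticOnNhd {G : Type*} [NormedAddCommGroup G]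
    [InnerProductSpace ℂ G] {F : ℂ → G →L[ℂ] G} {Ω : Set ℂ} {z₀ : ℂ}
    (hF : AnalyticOnNhd ℂ F (Ω \ {z₀})) (hz₀ : IsFinMeroAt F z₀) : FinitelyMeromorphicOn F Ω := by
  intro z hz
  obtain rfl | hne := eq_or_ne z z₀
  · exact hz₀
  · exact isFinMeroAt_of_analyticAt (hF z ⟨hz, hne⟩)

theorem eventually_sphere_subset {s : Set ℂ} (hs : s ∈ 𝓝[≠] z₀) :
    ∀ᶠ r in 𝓝[>] (0 : ℝ), Metric.sphere z₀ r ⊆ s := by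
  filter_upwards [nhdsWithin_le_nhds (eventually_closedBall_subset (insert_mem_nhds_iff.2 hs)),
    self_mem_nhdsWithin] with r hr hr0 z hz
  exact (hr (Metric.sphere_subset_closedBall hz)).resolve_left
    (Metric.ne_of_mem_sphere hz (ne_of_gt hr0))

theorem IsFinMeroAt.eventually_continuousOn_sphere [CompleteSpace F] {f : ℂ → E →L[ℂ] F}
    (hf : IsFinMeroAt f z₀) : ∀ᶠ r in 𝓝[>] (0 : ℝ), ContinuousOn f (Metric.sphere z₀ r) :=
  (eventually_sphere_subset hf.meromorphicAt.eventually_analyticAt).mono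
    fun _ hr _ hz => (hr hz).continuousAt.continuousWithinAt

theorem eventually_differentiableOn_closedBall {X : Type*} [NormedAddCommGroup X]
    [NormedSpace ℂ X] [CompleteSpace X] {f : ℂ → X} (hf : AnalyticAt ℂ f z₀) :
    ∀ᶠ r in 𝓝[>] (0 : ℝ), DifferentiableOn ℂ f (Metric.closedBall z₀ r) :=
  ((eventually_closedBall_subset hf.eventually_analyticAt).filter_mono nhdsWithin_le_nhds).mono
    fun _ hr _ hz => (hr hz).differentiableAt.differentiableWithinAt

end FinitelyMeromorphic

/-! ### Traces of residues of products -/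

section ResidueTraceComm

variable {E F : Type*} [NormedAddCommGroup E] [InnerProductSpace ℂ E]
  [NormedAddCommGroup F] [InnerProductSpace ℂ F] {z₀ : ℂ} {r : ℝ}

/-- Cyclicity of the trace under the residue integral: the residues of `a c` and `c a` have finite
rank and the same trace. -/
def ResidueTraceComm (a : ℂ → E →L[ℂ] F) (c : ℂ → F →L[ℂ] E) (z₀ : ℂ) (r : ℝ) : Prop :=
  HasFiniteRank (residueIntegral (fun z => a z ∘L c z) z₀ r) ∧
    HasFiniteRank (residueIntegral (fun z => c z ∘L a z) z₀ r) ∧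
    finiteRankTrace (residueIntegral (fun z => a z ∘L c z) z₀ r) =
      finiteRankTrace (residueIntegral (fun z => c z ∘L a z) z₀ r)

theorem ResidueTraceComm.symm {a : ℂ → E →L[ℂ] F} {c : ℂ → F →L[ℂ] E}
    (h : ResidueTraceComm a c z₀ r) : ResidueTraceComm c a z₀ r :=
  ⟨h.2.1, h.1, h.2.2.symm⟩

theorem ResidueTraceComm.congr_left {a a' : ℂ → E →L[ℂ] F} {c : ℂ → F →L[ℂ] E} (hr : 0 ≤ r)
    (ha : Set.EqOn a a' (Metric.sphere z₀ r)) (h : ResidueTraceComm a c z₀ r) :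
    ResidueTraceComm a' c z₀ r := by
  rwa [ResidueTraceComm, residueIntegral_congr (f := fun z => a' z ∘L c z)
      (g := fun z => a z ∘L c z) hr fun z hz => by simp only [ha hz],
    residueIntegral_congr (f := fun z => c z ∘L a' z)
      (g := fun z => c z ∘L a z) hr fun z hz => by simp only [ha hz]]

theorem ResidueTraceComm.add_left {a a' : ℂ → E →L[ℂ] F} {c : ℂ → F →L[ℂ] E} (hr : 0 ≤ r)
    (h : ResidueTraceComm a c z₀ r) (h' : ResidueTraceComm a' c z₀ r)
    (ha : ContinuousOn a (Metric.sphere z₀ r)) (ha' : ContinuousOn a' (Metric.sphere z₀ r))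
    (hc : ContinuousOn c (Metric.sphere z₀ r)) : ResidueTraceComm (a + a') c z₀ r := by
  simp only [ResidueTraceComm, Pi.add_apply, ContinuousLinearMap.add_comp,
    ContinuousLinearMap.comp_add]
  rw [residueIntegral_add ((ha.clm_comp hc).circleIntegrable hr)
      ((ha'.clm_comp hc).circleIntegrable hr),
    residueIntegral_add ((hc.clm_comp ha).circleIntegrable hr)
      ((hc.clm_comp ha').circleIntegrable hr),
    finiteRankTrace_add h.1 h'.1, finiteRankTrace_add h.2.1 h'.2.1, h.2.2, h'.2.2]
  exact ⟨h.1.add h'.1, h.2.1.add h'.2.1, rfl⟩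

theorem residueTraceComm_smul_const_left [CompleteSpace E] [CompleteSpace F] (hr : 0 ≤ r)
    {f : ℂ → ℂ} {A : E →L[ℂ] F} {c : ℂ → F →L[ℂ] E} (hA : HasFiniteRank A)
    (hf : ContinuousOn f (Metric.sphere z₀ r)) (hc : ContinuousOn c (Metric.sphere z₀ r)) :
    ResidueTraceComm (fun z => f z • A) c z₀ r := by
  have hint : CircleIntegrable (fun z => f z • c z) z₀ r := (hf.smul hc).circleIntegrable hr
  have hleft : residueIntegral (fun z => (f z • A) ∘L c z) z₀ r =
      A ∘L residueIntegral (fun z => f z • c z) z₀ r := by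
    simpa using residueIntegral_comp_left A hint
  have hright : residueIntegral (fun z => c z ∘L (f z • A)) z₀ r =
      residueIntegral (fun z => f z • c z) z₀ r ∘L A := by
    simpa using residueIntegral_comp_right A hint
  rw [ResidueTraceComm, hleft, hright]
  exact ⟨hA.comp_right _, hA.comp_left _, finiteRankTrace_comp_comm hA _⟩

theorem residueTraceComm_of_differentiableOn {a : ℂ → E →L[ℂ] F} {c : ℂ → F →L[ℂ] E} (hr : 0 ≤ r)
    (ha : DifferentiableOn ℂ a (Metric.closedBall z₀ r))
    (hc : DifferentiableOn ℂ c (Metric.closedBall z₀ r)) : ResidueTraceComm a c z₀ r := by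
  rw [ResidueTraceComm, residueIntegral_eq_zero hr (ha.clm_comp hc),
    residueIntegral_eq_zero hr (hc.clm_comp ha), finiteRankTrace_zero, finiteRankTrace_zero]
  exact ⟨hasFiniteRank_zero, hasFiniteRank_zero, rfl⟩

variable [CompleteSpace E] [CompleteSpace F]

theorem IsFinMeroAt.eventually_residueTraceComm_of_analyticAt {a : ℂ → E →L[ℂ] F}
    {c : ℂ → F →L[ℂ] E} (hc : IsFinMeroAt c z₀)
    (analytic : ∀ g : ℂ → E →L[ℂ] F, AnalyticAt ℂ g z₀ →
      ∀ᶠ r in 𝓝[>] (0 : ℝ), ResidueTraceComm g c z₀ r) (ha : IsFinMeroAt a z₀) :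
    ∀ᶠ r in 𝓝[>] (0 : ℝ), ResidueTraceComm a c z₀ r := by
  refine ha.induction_on analytic (fun A k hA => ?_) (fun g h hg hh hgc hhc => ?_)
    fun g h hgh hgc => ?_
  · filter_upwards [hc.eventually_continuousOn_sphere, self_mem_nhdsWithin] with r hcr hr
    refine residueTraceComm_smul_const_left (le_of_lt hr) hA
      (.inv₀ (by fun_prop) fun z hz => ?_) hcr
    exact pow_ne_zero _ (sub_ne_zero.2 (Metric.ne_of_mem_sphere hz (ne_of_gt hr)))
  · filter_upwards [hgc, hhc, hg.eventually_continuousOn_sphere, hh.eventually_continuousOn_sphere,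
      hc.eventually_continuousOn_sphere, self_mem_nhdsWithin] with r hgc hhc hg hh hc hr
    exact hgc.add_left (le_of_lt hr) hhc hg hh hc
  · filter_upwards [hgc, eventually_sphere_subset hgh, self_mem_nhdsWithin] with r hgc hgh hr
    exact hgc.congr_left (le_of_lt hr) hgh

theorem IsFinMeroAt.eventually_residueTraceComm {a : ℂ → E →L[ℂ] F} {c : ℂ → F →L[ℂ] E}
    (ha : IsFinMeroAt a z₀) (hc : IsFinMeroAt c z₀) :
    ∀ᶠ r in 𝓝[>] (0 : ℝ), ResidueTraceComm a c z₀ r := by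
  refine hc.eventually_residueTraceComm_of_analyticAt (fun g hg => ?_) ha
  refine ((isFinMeroAt_of_analyticAt hg).eventually_residueTraceComm_of_analyticAt
    (fun h hh => ?_) hc).mono fun r hr => hr.symm
  filter_upwards [eventually_differentiableOn_closedBall hg,
    eventually_differentiableOn_closedBall hh, self_mem_nhdsWithin] with r hg hh hr
  exact residueTraceComm_of_differentiableOn (le_of_lt hr) hh hg

end ResidueTraceComm

/-! ### Closed graphs and bounded inverses -/

section ClosedGraph

variable {E F : Type*} [NormedAddCommGroup E] [NormedSpace ℂ E] [NormedAddCommGroup F]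
  [NormedSpace ℂ F]

open scoped Classical in
/-- The bounded operator with graph `g`, and `0` if there is none. -/
def clmOfGraph (g : Submodule ℂ (E × F)) : E →L[ℂ] F :=
  if h : ∃ L : E →L[ℂ] F, ∀ x y, L x = y ↔ (x, y) ∈ g then h.choose else 0

variable [CompleteSpace E] [CompleteSpace F]

theorem exists_clm_of_isClosed {g : Submodule ℂ (E × F)} (hg : IsClosed (g : Set (E × F)))
    (h : ∀ x, ∃! y, (x, y) ∈ g) : ∃ L : E →L[ℂ] F, ∀ x y, L x = y ↔ (x, y) ∈ g := by
  choose f hf hunique using h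
  have hf' (x y) : f x = y ↔ (x, y) ∈ g := ⟨fun h => h ▸ hf x, fun h => (hunique x y h).symm⟩
  let L : E →ₗ[ℂ] F :=
    { toFun := f
      map_add' := fun x y => (hf' _ _).2 (g.add_mem (hf x) (hf y))
      map_smul' := fun c x => (hf' _ _).2 (g.smul_mem c (hf x)) }
  have hL : L.graph = g := by
    ext ⟨x, y⟩
    rw [LinearMap.mem_graph_iff, ← hf']
    exact eq_comm
  exact ⟨.ofIsClosedGraph (g := L) (hL ▸ hg), hf'⟩

theorem clmOfGraph_apply_eq_iff {g : Submodule ℂ (E × F)} (hg : IsClosed (g : Set (E × F)))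
    (h : ∀ x, ∃! y, (x, y) ∈ g) {x : E} {y : F} : clmOfGraph g x = y ↔ (x, y) ∈ g := by
  have hL := exists_clm_of_isClosed hg h
  rw [clmOfGraph, dif_pos hL]
  exact hL.choose_spec x y

end ClosedGraph

section BoundedInverse

variable {E : Type*} [NormedAddCommGroup E] [InnerProductSpace ℂ E] {A : E →ₗ.[ℂ] E}

theorem IsBoundedInverse.boundedInverse_eq {R : E →L[ℂ] E} (h : IsBoundedInverse A R) :
    boundedInverse A = R := by
  have hA : BoundedlyInvertible A := ⟨R, h⟩
  rw [boundedInverse, dif_pos hA]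
  ext y
  exact (hA.choose_spec (R y) y).1 ((h (R y) y).2 rfl)

theorem BoundedlyInvertible.boundedInverse_apply_eq_iff (hA : BoundedlyInvertible A) {x y : E} :
    boundedInverse A y = x ↔ (x, y) ∈ A.graph := by
  obtain ⟨R, hR⟩ := hA
  rw [hR.boundedInverse_eq, hR]

theorem BoundedlyInvertible.mem_graph (hA : BoundedlyInvertible A) (y : E) :
    (boundedInverse A y, y) ∈ A.graph :=
  hA.boundedInverse_apply_eq_iff.1 rfl

theorem boundedlyInvertible_of_isClosed [CompleteSpace E] (hA : A.IsClosed)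
    (h : ∀ y, ∃! x, (x, y) ∈ A.graph) : BoundedlyInvertible A := by
  obtain ⟨R, hR⟩ := exists_clm_of_isClosed
    (g := A.graph.comap (LinearEquiv.prodComm ℂ E E).toLinearMap) (hA.preimage continuous_swap) h
  exact ⟨R, fun x y => (hR y x).symm⟩

end BoundedInverse

/-! ### Resolvents -/

section Resolvents

variable {E : Type*} [NormedAddCommGroup E] [InnerProductSpace ℂ E] {T : E →ₗ.[ℂ] E} {z w : ℂ}

theorem mem_graph_subScalar {x y : E} :
    (x, y) ∈ (subScalar T z).graph ↔ (x, y + z • x) ∈ T.graph := by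
  simp only [LinearPMap.mem_graph_iff]
  refine exists_congr fun u => and_congr_right fun hu => ?_
  rw [← hu, ← sub_eq_iff_eq_add]
  rfl

/-- The resolvent `(T - z)⁻¹`; it is `0` for `z` outside the resolvent set. -/
def resolventOp (T : E →ₗ.[ℂ] E) (z : ℂ) : E →L[ℂ] E :=
  boundedInverse (subScalar T z)

theorem resolventOp_apply_eq_iff (hz : z ∈ resolventSet T) {x y : E} :
    resolventOp T z y = x ↔ (x, y + z • x) ∈ T.graph :=
  hz.boundedInverse_apply_eq_iff.trans mem_graph_subScalar

theorem mem_graph_resolventOp (hz : z ∈ resolventSet T) (y : E) :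
    (resolventOp T z y, y + z • resolventOp T z y) ∈ T.graph :=
  (resolventOp_apply_eq_iff hz).1 rfl

theorem resolventOp_sub_smul (hz : z ∈ resolventSet T) {x y : E} (h : (x, y) ∈ T.graph) :
    resolventOp T z (y - z • x) = x :=
  (resolventOp_apply_eq_iff hz).2 (by simpa using h)

theorem resolventOp_injective (hz : z ∈ resolventSet T) :
    Function.Injective (resolventOp T z) := by
  refine (injective_iff_map_eq_zero _).2 fun y hy => ?_
  have h := mem_graph_resolventOp hz y
  rw [hy, smul_zero, add_zero] at h
  exact T.graph_fst_eq_zero_snd h rfl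

theorem resolventOp_add_smul (hz : z ∈ resolventSet T) (hw : w ∈ resolventSet T) (y : E) :
    resolventOp T w (y + (z - w) • resolventOp T z y) = resolventOp T z y := by
  rw [resolventOp_apply_eq_iff hw]
  convert mem_graph_resolventOp hz y using 2
  module

theorem resolventOp_sub (hz : z ∈ resolventSet T) (hw : w ∈ resolventSet T) :
    resolventOp T z - resolventOp T w = (z - w) • (resolventOp T z ∘L resolventOp T w) := by
  ext y
  have h := resolventOp_add_smul hw hz y
  rw [map_add, map_smul] at h
  simp only [sub_apply, smul_apply, ContinuousLinearMap.comp_apply]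
  linear_combination (norm := module) h

theorem resolventOp_comm (hz : z ∈ resolventSet T) (hw : w ∈ resolventSet T) :
    resolventOp T z ∘L resolventOp T w = resolventOp T w ∘L resolventOp T z := by
  rcases eq_or_ne z w with rfl | h
  · rfl
  refine smul_right_injective _ (sub_ne_zero.2 h) ?_
  simp only
  rw [← resolventOp_sub hz hw, ← neg_sub w z, neg_smul, ← resolventOp_sub hw hz, neg_sub]

theorem resolventOp_eq_inverse_comp (hw : w ∈ resolventSet T)
    (h : IsUnit (1 - (z - w) • resolventOp T w)) : z ∈ resolventSet T ∧
      resolventOp T z = Ring.inverse (1 - (z - w) • resolventOp T w) ∘L resolventOp T w := by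
  have hinv : IsBoundedInverse (subScalar T z)
      (Ring.inverse (1 - (z - w) • resolventOp T w) ∘L resolventOp T w) := fun x y => by
    have hsplit : y + z • x = (y + (z - w) • x) + w • x := by module
    rw [mem_graph_subScalar, hsplit, ← resolventOp_apply_eq_iff hw, map_add, map_smul,
      ← eq_sub_iff_add_eq]
    obtain ⟨U, hU⟩ := h
    have hUx : x - (z - w) • resolventOp T w x = (U : E →L[ℂ] E) x := by simp [hU]
    rw [hUx, ← hU, Ring.inverse_unit]
    exact ⟨fun h => by rw [ContinuousLinearMap.comp_apply, h]; exact congr($U.inv_mul x),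
      fun h => by rw [← h]; exact congr($U.mul_inv (resolventOp T w y)).symm⟩
  exact ⟨⟨_, hinv⟩, hinv.boundedInverse_eq⟩

theorem mem_kerPow_succ {n : ℕ} {x : E} :
    x ∈ kerPow T z (n + 1) ↔ ∃ y ∈ kerPow T z n, (x, y + z • x) ∈ T.graph := by
  simp only [kerPow, Submodule.mem_map, Submodule.mem_comap]
  constructor
  · rintro ⟨u, hu, rfl⟩
    exact ⟨_, hu, mem_graph_subScalar.1 (LinearPMap.mem_graph _ u)⟩
  · rintro ⟨y, hy, h⟩
    obtain ⟨u, rfl, rfl⟩ := (LinearPMap.mem_graph_iff _).1 (mem_graph_subScalar.2 h)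
    exact ⟨u, hy, rfl⟩

theorem algebraicEigenspace_eq_bot (hz : z ∈ resolventSet T) : algebraicEigenspace T z = ⊥ := by
  refine iSup_eq_bot.2 fun n => ?_
  induction n with
  | zero => rfl
  | succ n ih =>
    refine (Submodule.eq_bot_iff _).2 fun x hx => ?_
    obtain ⟨y, hy, h⟩ := mem_kerPow_succ.1 hx
    rw [ih, Submodule.mem_bot] at hy
    rw [← (resolventOp_apply_eq_iff hz).2 h, hy, map_zero]

variable [CompleteSpace E]

theorem eventually_resolventOp_eq_inverse_comp (hw : w ∈ resolventSet T) :
    ∀ᶠ z in 𝓝 w, z ∈ resolventSet T ∧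
      resolventOp T z = Ring.inverse (1 - (z - w) • resolventOp T w) ∘L resolventOp T w := by
  have hc : ContinuousAt (fun z => ‖(z - w) • resolventOp T w‖) w := by fun_prop
  filter_upwards [hc.eventually_lt (continuousAt_const (y := (1 : ℝ))) (by simp)] with z hz
  exact resolventOp_eq_inverse_comp hw (isUnit_one_sub_of_norm_lt_one hz)

theorem isOpen_resolventSet : IsOpen (resolventSet T) :=
  isOpen_iff_mem_nhds.2 fun _ hw =>
    (eventually_resolventOp_eq_inverse_comp hw).mono fun _ hz => hz.1

theorem analyticAt_resolventOp (hw : w ∈ resolventSet T) : AnalyticAt ℂ (resolventOp T) w := by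
  have hinv : AnalyticAt ℂ (Ring.inverse : (E →L[ℂ] E) → E →L[ℂ] E)
      (1 - (w - w) • resolventOp T w) := by
    simpa using analyticAt_inverse (𝕜 := ℂ) (1 : (E →L[ℂ] E)ˣ)
  refine (analyticAt_clm_comp
    (hinv.comp (f := fun z => 1 - (z - w) • resolventOp T w) (by fun_prop))
    (analyticAt_const (v := resolventOp T w))).congr ?_
  filter_upwards [eventually_resolventOp_eq_inverse_comp hw] with z hz using hz.2.symm

end Resolvents

/-! ### Isolated points of the spectrum -/

section Nilpotent

theorem isNilpotent_of_forall_hasEigenvalue {K V : Type*} [Field K] [IsAlgClosed K]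
    [AddCommGroup V] [Module K V] [FiniteDimensional K V] {N : Module.End K V}
    (h : ∀ μ, N.HasEigenvalue μ → μ = 0) : IsNilpotent N := by
  have hroots : N.charpoly.roots = Multiset.replicate (Module.finrank K V) 0 := by
    refine Multiset.eq_replicate.2 ⟨?_, fun μ hμ => h μ ?_⟩
    · rw [IsAlgClosed.card_roots_eq_natDegree, LinearMap.charpoly_natDegree]
    · exact (Module.End.hasEigenvalue_iff_isRoot_charpoly N μ).2 (Polynomial.isRoot_of_mem_roots hμ)
  rw [LinearMap.isNilpotent_iff_charpoly,
    (IsAlgClosed.splits N.charpoly).eq_prod_roots_of_monic N.charpoly_monic, hroots]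
  simp

theorem sub_smul_mul_sum_inv_pow_smul {K A : Type*} [Field K] [Ring A] [Algebra K A] {N : A}
    {n : ℕ} (hN : N ^ n = 0) {t : K} (ht : t ≠ 0) :
    (N - t • 1) * -∑ k ∈ Finset.range n, (t ^ (k + 1))⁻¹ • N ^ k = 1 := by
  have hfactor : N - t • 1 = t • (t⁻¹ • N - 1) := by
    rw [smul_sub, smul_inv_smul₀ ht]
  have hsum : -∑ k ∈ Finset.range n, (t ^ (k + 1))⁻¹ • N ^ k =
      t⁻¹ • -∑ k ∈ Finset.range n, (t⁻¹ • N) ^ k := by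
    simp only [smul_neg, Finset.smul_sum, smul_pow, smul_smul, inv_pow, pow_succ', mul_inv]
  rw [hfactor, hsum, smul_mul_smul_comm, mul_inv_cancel₀ ht, mul_neg, mul_geom_sum, smul_pow, hN]
  simp

end Nilpotent

section RieszProjection

variable {E : Type*} [NormedAddCommGroup E] [InnerProductSpace ℂ E]
  {T : E →ₗ.[ℂ] E} {z₀ : ℂ} {ε r : ℝ}

theorem sphere_subset_ball_diff (hr : r ∈ Set.Ioo 0 ε) :
    Metric.sphere z₀ r ⊆ Metric.ball z₀ ε \ {z₀} := fun _ hζ =>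
  ⟨Metric.sphere_subset_ball hr.2 hζ, Metric.ne_of_mem_sphere hζ hr.1.ne'⟩

theorem neg_residueIntegral_resolventOp :
    -residueIntegral (resolventOp T) z₀ r = rieszProjection T z₀ r := rfl

/-- The range of the Riesz projection, a candidate for the algebraic eigenspace at `z₀`. -/
abbrev rieszRange (T : E →ₗ.[ℂ] E) (z₀ : ℂ) (r : ℝ) : Submodule ℂ E :=
  LinearMap.range (rieszProjection T z₀ r).toLinearMap

variable [CompleteSpace E]

theorem differentiableOn_resolventOp {s : Set ℂ} (hs : s ⊆ resolventSet T) :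
    DifferentiableOn ℂ (resolventOp T) s := fun _ hζ =>
  (analyticAt_resolventOp (hs hζ)).differentiableAt.differentiableWithinAt

theorem circleIntegrable_resolventOp (hr : 0 ≤ r) (hs : Metric.sphere z₀ r ⊆ resolventSet T) :
    CircleIntegrable (resolventOp T) z₀ r :=
  (differentiableOn_resolventOp hs).continuousOn.circleIntegrable hr

theorem resolventOp_comp_rieszProjection (hr : 0 ≤ r)
    (hs : Metric.sphere z₀ r ⊆ resolventSet T) {w : ℂ} (hw : w ∈ resolventSet T) :
    resolventOp T w ∘L rieszProjection T z₀ r = rieszProjection T z₀ r ∘L resolventOp T w := by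
  have hi := circleIntegrable_resolventOp hr hs
  rw [← neg_residueIntegral_resolventOp, ContinuousLinearMap.comp_neg,
    ContinuousLinearMap.neg_comp, ← residueIntegral_comp_left _ hi,
    ← residueIntegral_comp_right _ hi]
  exact congrArg Neg.neg (residueIntegral_congr hr fun ζ hζ => resolventOp_comm hw (hs hζ))

theorem rieszProjection_comp_resolventOp (hs : Metric.sphere z₀ r ⊆ resolventSet T) {w : ℂ}
    (hw : w ∈ resolventSet T) (hwr : w ∈ Metric.ball z₀ r) :
    rieszProjection T z₀ r ∘L resolventOp T w =
      resolventOp T w - residueIntegral (fun ζ => (ζ - w)⁻¹ • resolventOp T ζ) z₀ r := by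
  have hr : 0 ≤ r := (Metric.pos_of_mem_ball hwr).le
  have hne : ∀ ζ ∈ Metric.sphere z₀ r, ζ - w ≠ 0 := fun ζ hζ h =>
    (Metric.mem_ball.1 hwr).ne (by rw [← sub_eq_zero.1 h]; exact hζ)
  have hinv : ContinuousOn (fun ζ => (ζ - w)⁻¹) (Metric.sphere z₀ r) :=
    ContinuousOn.inv₀ (by fun_prop) hne
  have hcomp : residueIntegral (fun ζ => resolventOp T ζ ∘L resolventOp T w) z₀ r =
      residueIntegral
        (fun ζ => (ζ - w)⁻¹ • resolventOp T ζ - (ζ - w)⁻¹ • resolventOp T w) z₀ r :=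
    residueIntegral_congr hr fun ζ hζ => by
      simp only [← smul_sub, resolventOp_sub (hs hζ) hw, smul_smul, inv_mul_cancel₀ (hne ζ hζ),
        one_smul]
  have hiζ : CircleIntegrable (fun ζ => (ζ - w)⁻¹ • resolventOp T ζ) z₀ r :=
    (hinv.smul (differentiableOn_resolventOp hs).continuousOn).circleIntegrable hr
  have hiw : CircleIntegrable (fun ζ => (ζ - w)⁻¹ • resolventOp T w) z₀ r :=
    (hinv.smul continuousOn_const).circleIntegrable hr
  rw [← neg_residueIntegral_resolventOp, ContinuousLinearMap.neg_comp,
    ← residueIntegral_comp_right _ (circleIntegrable_resolventOp hr hs), hcomp,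
    residueIntegral_sub hiζ hiw, residueIntegral_sub_inv_smul hwr, neg_sub]

theorem analyticOnNhd_residueIntegral_sub_inv_smul_resolventOp (hr : 0 < r)
    (hs : Metric.sphere z₀ r ⊆ resolventSet T) :
    AnalyticOnNhd ℂ (fun w => residueIntegral (fun ζ => (ζ - w)⁻¹ • resolventOp T ζ) z₀ r)
      (Metric.ball z₀ r) := by
  have hi := circleIntegrable_resolventOp hr.le hs
  lift r to NNReal using hr.le
  have := (hasFPowerSeriesOn_cauchy_integral hi (by exact_mod_cast hr)).analyticOnNhd
  rwa [Metric.eball_coe] at this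

theorem isIdempotentElem_rieszProjection (hρ : Metric.ball z₀ ε \ {z₀} ⊆ resolventSet T)
    (hr : r ∈ Set.Ioo 0 ε) : IsIdempotentElem (rieszProjection T z₀ r) := by
  obtain ⟨s, hs0, hsr⟩ := exists_between hr.1
  have hs : s ∈ Set.Ioo 0 ε := ⟨hs0, hsr.trans hr.2⟩
  have hsρ := (sphere_subset_ball_diff hs).trans hρ
  have hrρ := (sphere_subset_ball_diff hr).trans hρ
  have hi := circleIntegrable_resolventOp hs0.le hsρ
  have hcauchy : DifferentiableOn ℂ
      (fun w => residueIntegral (fun ζ => (ζ - w)⁻¹ • resolventOp T ζ) z₀ r)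
      (Metric.closedBall z₀ s) := fun w hw =>
    (analyticOnNhd_residueIntegral_sub_inv_smul_resolventOp hr.1 hrρ w
      (Metric.closedBall_subset_ball hsr hw)).differentiableAt.differentiableWithinAt
  have hP : -residueIntegral (resolventOp T) z₀ s = rieszProjection T z₀ r := by
    rw [← neg_residueIntegral_resolventOp,
      residueIntegral_eq_of_differentiableOn (differentiableOn_resolventOp hρ) hs hr]
  calc rieszProjection T z₀ r ∘L rieszProjection T z₀ r
    _ = -residueIntegral (fun w => rieszProjection T z₀ r ∘L resolventOp T w) z₀ s := by
      rw [residueIntegral_comp_left _ hi, ← ContinuousLinearMap.comp_neg, hP]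
    _ = -residueIntegral (fun w => resolventOp T w -
          residueIntegral (fun ζ => (ζ - w)⁻¹ • resolventOp T ζ) z₀ r) z₀ s :=
      congrArg Neg.neg <| residueIntegral_congr hs0.le fun w hw =>
        rieszProjection_comp_resolventOp hrρ (hsρ hw) (Metric.sphere_subset_ball hsr hw)
    _ = rieszProjection T z₀ r := by
      rw [residueIntegral_sub hi
          ((hcauchy.continuousOn.mono Metric.sphere_subset_closedBall).circleIntegrable hs0.le),
        residueIntegral_eq_zero hs0.le hcauchy, sub_zero, hP]

theorem rieszProjection_apply_eigenvector (hr : 0 ≤ r) (hs : Metric.sphere z₀ r ⊆ resolventSet T)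
    {l : ℂ} {x : E} (hx : (x, l • x) ∈ T.graph) (hl : l ∉ Metric.sphere z₀ r) :
    rieszProjection T z₀ r x = residueIntegral (fun ζ => (ζ - l)⁻¹ • x) z₀ r := by
  have happly := residueIntegral_clm_apply (ContinuousLinearMap.apply ℂ E x)
    (circleIntegrable_resolventOp hr hs)
  simp only [ContinuousLinearMap.apply_apply] at happly
  rw [← neg_residueIntegral_resolventOp, neg_apply, ← happly, ← residueIntegral_neg]
  refine residueIntegral_congr hr fun ζ hζ => ?_
  have hne : ζ - l ≠ 0 := sub_ne_zero.2 fun h => hl (h ▸ hζ)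
  have hres := resolventOp_sub_smul (hs hζ) hx
  rw [← sub_smul, map_smul, ← neg_sub, neg_smul, ← smul_neg] at hres
  exact (eq_inv_smul_iff₀ hne).2 hres

theorem rieszProjection_apply_of_mem_graph (hr : 0 < r)
    (hs : Metric.sphere z₀ r ⊆ resolventSet T) {x : E} (hx : (x, z₀ • x) ∈ T.graph) :
    rieszProjection T z₀ r x = x := by
  rw [rieszProjection_apply_eigenvector hr.le hs hx
    fun h => Metric.ne_of_mem_sphere h hr.ne' rfl,
    residueIntegral_sub_inv_smul (Metric.mem_ball_self hr)]

theorem rieszProjection_apply_eq_zero (hρ : Metric.ball z₀ ε \ {z₀} ⊆ resolventSet T)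
    (hr : r ∈ Set.Ioo 0 ε) {l : ℂ} {x : E} (hx : (x, l • x) ∈ T.graph) (hl : l ≠ z₀) :
    rieszProjection T z₀ r x = 0 := by
  by_cases hlε : l ∈ Metric.ball z₀ ε
  · rw [← resolventOp_sub_smul (hρ ⟨hlε, hl⟩) hx, sub_self, map_zero, map_zero]
  · have hlr : l ∉ Metric.closedBall z₀ r := fun h => hlε (Metric.closedBall_subset_ball hr.2 h)
    rw [rieszProjection_apply_eigenvector hr.1.le ((sphere_subset_ball_diff hr).trans hρ) hx
      fun h => hlr (Metric.sphere_subset_closedBall h)]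
    refine residueIntegral_eq_zero hr.1.le fun ζ hζ => ?_
    have hne : ζ - l ≠ 0 := sub_ne_zero.2 fun h => hlr (h ▸ hζ)
    exact (((differentiableAt_id.sub_const l).inv hne).smul_const x).differentiableWithinAt

theorem rieszProjection_mem_graph (hr : 0 ≤ r) (hs : Metric.sphere z₀ r ⊆ resolventSet T)
    {x y : E} (h : (x, y) ∈ T.graph) :
    (rieszProjection T z₀ r x, rieszProjection T z₀ r y) ∈ T.graph := by
  obtain ⟨w, hw⟩ := (NormedSpace.sphere_nonempty (x := z₀)).2 hr
  have hcomm : resolventOp T w (rieszProjection T z₀ r (y - w • x)) = rieszProjection T z₀ r x := by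
    rw [← ContinuousLinearMap.comp_apply, resolventOp_comp_rieszProjection hr hs (hs hw),
      ContinuousLinearMap.comp_apply, resolventOp_sub_smul (hs hw) h]
  simpa using (resolventOp_apply_eq_iff (hs hw)).1 hcomm

theorem rieszProjection_apply_of_mem_kerPow (hρ : Metric.ball z₀ ε \ {z₀} ⊆ resolventSet T)
    (hr : r ∈ Set.Ioo 0 ε) (n : ℕ) {x : E} (hx : x ∈ kerPow T z₀ n) :
    rieszProjection T z₀ r x = x := by
  have hs := (sphere_subset_ball_diff hr).trans hρ
  induction n generalizing x with
  | zero => rw [(Submodule.mem_bot ℂ).1 hx, map_zero]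
  | succ n ih =>
    obtain ⟨y, hy, h⟩ := mem_kerPow_succ.1 hx
    have hker := T.graph.sub_mem h (rieszProjection_mem_graph hr.1.le hs h)
    rw [map_add, ih hy, map_smul, Prod.mk_sub_mk, add_sub_add_left_eq_sub, ← smul_sub] at hker
    have hsub := rieszProjection_apply_of_mem_graph hr.1 hs hker
    have hPP : rieszProjection T z₀ r (rieszProjection T z₀ r x) = rieszProjection T z₀ r x :=
      congr($(isIdempotentElem_rieszProjection hρ hr) x)
    rw [map_sub, hPP, sub_self] at hsub
    exact (sub_eq_zero.1 hsub.symm).symm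

theorem exists_end_rieszRange (hr : 0 ≤ r)
    (hs : Metric.sphere z₀ r ⊆ resolventSet T) (hP : HasFiniteRank (rieszProjection T z₀ r)) :
    ∃ N : Module.End ℂ (rieszRange T z₀ r),
      ∀ x : rieszRange T z₀ r, ((x : E), (N x : E) + z₀ • (x : E)) ∈ T.graph := by
  obtain ⟨w, hw⟩ := (NormedSpace.sphere_nonempty (x := z₀)).2 hr
  rw [HasFiniteRank] at hP
  have hmaps : ∀ x ∈ rieszRange T z₀ r,
      resolventOp T w x ∈ rieszRange T z₀ r := by
    rintro _ ⟨x, rfl⟩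
    exact ⟨resolventOp T w x, congr($(resolventOp_comp_rieszProjection hr hs (hs hw)) x).symm⟩
  let e := LinearEquiv.ofInjectiveEndo ((resolventOp T w).toLinearMap.restrict hmaps)
    fun x y h => Subtype.ext (resolventOp_injective (hs hw) congr(($h : E)))
  refine ⟨e.symm.toLinearMap + (w - z₀) • LinearMap.id, fun x => ?_⟩
  have hgraph := (resolventOp_apply_eq_iff (hs hw)).1 congr(($(e.apply_symm_apply x) : E))
  convert hgraph using 2
  simp only [LinearMap.add_apply, LinearEquiv.coe_coe, LinearMap.smul_apply, LinearMap.id_apply,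
    Submodule.coe_add, Submodule.coe_smul, Submodule.subtype_apply]
  module

theorem exists_isNilpotent_rieszRange
    (hρ : Metric.ball z₀ ε \ {z₀} ⊆ resolventSet T) (hr : r ∈ Set.Ioo 0 ε)
    (hP : HasFiniteRank (rieszProjection T z₀ r)) :
    ∃ N : Module.End ℂ (rieszRange T z₀ r),
      IsNilpotent N ∧ ∀ x : rieszRange T z₀ r, ((x : E), (N x : E) + z₀ • (x : E)) ∈ T.graph := by
  obtain ⟨N, hN⟩ :=
    exists_end_rieszRange hr.1.le ((sphere_subset_ball_diff hr).trans hρ) hP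
  rw [HasFiniteRank] at hP
  refine ⟨N, isNilpotent_of_forall_hasEigenvalue fun μ hμ => ?_, hN⟩
  obtain ⟨v, hv⟩ := hμ.exists_hasEigenvector
  by_contra hμ0
  have heigen := hN v
  rw [hv.apply_eq_smul, Submodule.coe_smul, ← add_smul] at heigen
  have hPv : rieszProjection T z₀ r v = v := by
    obtain ⟨x, hx⟩ := v.2
    rw [← hx]
    exact congr($(isIdempotentElem_rieszProjection hρ hr) x)
  refine hv.2 (Subtype.ext ?_)
  rw [← hPv, rieszProjection_apply_eq_zero hρ hr heigen (by simpa using hμ0), Submodule.coe_zero]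

theorem algebraicEigenspace_eq_rieszRange
    (hρ : Metric.ball z₀ ε \ {z₀} ⊆ resolventSet T) (hr : r ∈ Set.Ioo 0 ε)
    (hP : HasFiniteRank (rieszProjection T z₀ r)) :
    algebraicEigenspace T z₀ = rieszRange T z₀ r := by
  refine le_antisymm
    (iSup_le fun n x hx => ⟨x, rieszProjection_apply_of_mem_kerPow hρ hr n hx⟩) fun x hx => ?_
  obtain ⟨N, ⟨n, hn⟩, hN⟩ := exists_isNilpotent_rieszRange hρ hr hP
  have mem_kerPow (k : ℕ) (x : rieszRange T z₀ r)
      (hx : (N ^ k) x = 0) : (x : E) ∈ kerPow T z₀ k := by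
    induction k generalizing x with
    | zero =>
      rw [show x = 0 from hx]
      exact zero_mem _
    | succ k ih => exact mem_kerPow_succ.2 ⟨N x, ih _ (by rwa [pow_succ] at hx), hN x⟩
  exact Submodule.mem_iSup_of_mem n (mem_kerPow n ⟨x, hx⟩ (by rw [hn]; rfl))

theorem exists_resolventOp_comp_rieszProjection_eq_sum
    (hρ : Metric.ball z₀ ε \ {z₀} ⊆ resolventSet T) (hr : r ∈ Set.Ioo 0 ε)
    (hP : HasFiniteRank (rieszProjection T z₀ r)) :
    ∃ (n : ℕ) (c : ℕ → E →L[ℂ] E), (∀ k, HasFiniteRank (c k)) ∧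
      ∀ z ∈ Metric.ball z₀ ε \ {z₀}, resolventOp T z ∘L rieszProjection T z₀ r =
        ∑ k ∈ Finset.range n, ((z - z₀) ^ (k + 1))⁻¹ • c k := by
  obtain ⟨N, ⟨n, hn⟩, hN⟩ := exists_isNilpotent_rieszRange hρ hr hP
  rw [HasFiniteRank] at hP
  let V := rieszRange T z₀ r
  let PV : E →L[ℂ] V := (rieszProjection T z₀ r).codRestrict V fun x => ⟨x, rfl⟩
  refine ⟨n, fun k => -(V.subtypeL ∘L LinearMap.toContinuousLinearMap (N ^ k) ∘L PV),
    fun k => .of_forall_mem V fun x => V.neg_mem (Subtype.coe_prop _), fun z hz => ?_⟩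
  ext y
  let S : Module.End ℂ V := -∑ k ∈ Finset.range n, ((z - z₀) ^ (k + 1))⁻¹ • N ^ k
  have hS : N (S (PV y)) - (z - z₀) • S (PV y) = PV y :=
    congr($(sub_smul_mul_sum_inv_pow_smul hn (sub_ne_zero.2 hz.2)) (PV y))
  have hgraph : ((S (PV y) : E), rieszProjection T z₀ r y + z • (S (PV y) : E)) ∈ T.graph := by
    convert hN (S (PV y)) using 2
    have hS' : (N (S (PV y)) : E) - (z - z₀) • (S (PV y) : E) = rieszProjection T z₀ r y :=
      congr(($hS : E))
    rw [← hS']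
    module
  rw [ContinuousLinearMap.comp_apply, (resolventOp_apply_eq_iff (hρ hz)).2 hgraph]
  simp [S]

theorem isFinMeroAt_resolventOp_of_hasFiniteRank
    (hρ : Metric.ball z₀ ε \ {z₀} ⊆ resolventSet T) (hr : r ∈ Set.Ioo 0 ε)
    (hP : HasFiniteRank (rieszProjection T z₀ r)) : IsFinMeroAt (resolventOp T) z₀ := by
  have hs := (sphere_subset_ball_diff hr).trans hρ
  obtain ⟨n, c, hc, hsum⟩ := exists_resolventOp_comp_rieszProjection_eq_sum hρ hr hP
  refine ⟨n, c, fun w => residueIntegral (fun ζ => (ζ - w)⁻¹ • resolventOp T ζ) z₀ r,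
    fun k _ => hc k, analyticOnNhd_residueIntegral_sub_inv_smul_resolventOp hr.1 hs z₀
      (Metric.mem_ball_self hr.1), ?_⟩
  filter_upwards [self_mem_nhdsWithin, nhdsWithin_le_nhds (Metric.ball_mem_nhds z₀ hr.1)]
    with z hz hzr
  have hzε : z ∈ Metric.ball z₀ ε \ {z₀} := ⟨Metric.ball_subset_ball hr.2.le hzr, hz⟩
  rw [← hsum z hzε, resolventOp_comp_rieszProjection hr.1.le hs (hρ hzε),
    rieszProjection_comp_resolventOp hs (hρ hzε) hzr, sub_add_cancel]

end RieszProjection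

section DiscreteSpectrum

variable {E : Type*} [NormedAddCommGroup E] [InnerProductSpace ℂ E] {T : E →ₗ.[ℂ] E}
  {z₀ : ℂ}

theorem ball_diff_subset_of_mem_discreteSpectrum (hz : z₀ ∈ discreteSpectrum T) :
    ∃ ε > 0, Metric.ball z₀ ε \ {z₀} ⊆ resolventSet T ∧
      ∀ r ∈ Set.Ioo 0 ε, HasFiniteRank (rieszProjection T z₀ r) := by
  obtain ⟨-, ε, hε, hρ, hP⟩ := hz
  exact ⟨ε, hε, fun ζ hζ => hρ ζ hζ.2 hζ.1, fun r hr => hP r hr.1 hr.2⟩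

variable [CompleteSpace E]

theorem eventually_mem_resolventSet (hz : z₀ ∈ discreteSpectrum T ∪ resolventSet T) :
    ∀ᶠ z in 𝓝[≠] z₀, z ∈ resolventSet T := by
  rcases hz with hz | hz
  · obtain ⟨ε, hε, hρ, -⟩ := ball_diff_subset_of_mem_discreteSpectrum hz
    filter_upwards [self_mem_nhdsWithin, nhdsWithin_le_nhds (Metric.ball_mem_nhds z₀ hε)]
      with z hz hzε using hρ ⟨hzε, hz⟩
  · exact nhdsWithin_le_nhds (isOpen_resolventSet.mem_nhds hz)

theorem isFinMeroAt_resolventOp (hz : z₀ ∈ discreteSpectrum T ∪ resolventSet T) :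
    IsFinMeroAt (resolventOp T) z₀ := by
  rcases hz with hz | hz
  · obtain ⟨ε, hε, hρ, hP⟩ := ball_diff_subset_of_mem_discreteSpectrum hz
    obtain ⟨r, hr⟩ := exists_between hε
    exact isFinMeroAt_resolventOp_of_hasFiniteRank hρ hr (hP r hr)
  · exact isFinMeroAt_of_analyticAt (analyticAt_resolventOp hz)

theorem eventually_finiteRankTrace_residueIntegral_resolventOp
    (hz : z₀ ∈ discreteSpectrum T ∪ resolventSet T) :
    ∀ᶠ r in 𝓝[>] (0 : ℝ), HasFiniteRank (residueIntegral (resolventOp T) z₀ r) ∧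
      finiteRankTrace (residueIntegral (resolventOp T) z₀ r) = -(algMult T z₀ : ℂ) := by
  rcases hz with hz | hz
  · obtain ⟨ε, hε, hρ, hP⟩ := ball_diff_subset_of_mem_discreteSpectrum hz
    filter_upwards [Ioo_mem_nhdsGT hε] with r hr
    rw [← neg_neg (residueIntegral _ _ _), neg_residueIntegral_resolventOp,
      finiteRankTrace_neg (hP r hr), algMult,
      algebraicEigenspace_eq_rieszRange hρ hr (hP r hr),
      finiteRankTrace_of_isIdempotentElem (hP r hr) (isIdempotentElem_rieszProjection hρ hr)]
    exact ⟨(hP r hr).neg, rfl⟩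
  · filter_upwards [eventually_differentiableOn_closedBall (analyticAt_resolventOp hz),
      self_mem_nhdsWithin] with r hdiff hr
    rw [residueIntegral_eq_zero (le_of_lt hr) hdiff, finiteRankTrace_zero, algMult,
      algebraicEigenspace_eq_bot hz]
    exact ⟨hasFiniteRank_zero, by simp⟩

end DiscreteSpectrum

/-! ### Boundary triples -/

section BoundaryTriples

variable {H : Type*} [NormedAddCommGroup H] [InnerProductSpace ℂ H]
variable {G : Type*} [NormedAddCommGroup G] [InnerProductSpace ℂ G]
variable {T : H →ₗ.[ℂ] H}

theorem mem_graph_restrictTo {L : Submodule ℂ T.domain} {f f' : H} :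
    (f, f') ∈ (restrictTo T L).graph ↔ ∃ x ∈ L, (x : H) = f ∧ T x = f' := by
  rw [LinearPMap.mem_graph_iff]
  constructor
  · rintro ⟨⟨_, ⟨x, hxL, rfl⟩, hx⟩, rfl, rfl⟩
    exact ⟨x, hxL, rfl, (LinearPMap.domRestrict_apply (f := T) rfl).symm⟩
  · rintro ⟨x, hxL, rfl, rfl⟩
    exact ⟨⟨x, ⟨x, hxL, rfl⟩, x.2⟩, rfl, LinearPMap.domRestrict_apply (f := T) rfl⟩

theorem IsDerivClosure.derivClosure_eq {M : ℂ → G →ₗ.[ℂ] G} {L : G →L[ℂ] G} {z : ℂ}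
    (hL : IsDerivClosure M z L) (hM : Dense ((M z).domain : Set G)) : derivClosure M z = L := by
  have hex : ∃ L, IsDerivClosure M z L := ⟨L, hL⟩
  rw [derivClosure, dif_pos hex]
  refine ContinuousLinearMap.coeFn_injective (Continuous.ext_on hM
    hex.choose.continuous L.continuous fun φ hφ => ?_)
  rw [hex.choose_spec φ hφ, hL φ hφ]

namespace BoundaryTriple

variable (b : BoundaryTriple T G)

/-- The graph of the boundary mapping `(f, T f) ↦ (Γ₀ f, Γ₁ f)`. -/
def graph : Submodule ℂ ((H × H) × (G × G)) :=
  LinearMap.range ((T.domain.subtype.prod T.toFun).prod (b.Γ₀.prod b.Γ₁))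

variable {b} {f f' g g' : H} {φ φ' ψ ψ' : G} {p q : G × G} {z w z₀ : ℂ} {r s ε : ℝ}
  {A : H →ₗ.[ℂ] H} {Θ : G →ₗ.[ℂ] G}

theorem mem_graph_iff : ((f, f'), (φ, ψ)) ∈ b.graph ↔
    ∃ x : T.domain, (x : H) = f ∧ T x = f' ∧ b.Γ₀ x = φ ∧ b.Γ₁ x = ψ := by
  simp only [graph, LinearMap.mem_range, LinearMap.prod_apply, Function.prod_apply, Prod.mk.injEq,
    Submodule.subtype_apply, LinearPMap.toFun_eq_coe, and_assoc]

theorem mem_graph (x : T.domain) : (((x : H), T x), (b.Γ₀ x, b.Γ₁ x)) ∈ b.graph :=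
  mem_graph_iff.2 ⟨x, rfl, rfl, rfl, rfl⟩

theorem boundary_eq (hp : ((f, f'), p) ∈ b.graph) (hq : ((f, g'), q) ∈ b.graph) : p = q := by
  obtain ⟨x, rfl, -, hx₀, hx₁⟩ := mem_graph_iff.1 hp
  obtain ⟨y, hxy, -, hy₀, hy₁⟩ := mem_graph_iff.1 hq
  obtain rfl := Subtype.ext hxy
  exact Prod.ext (hx₀.symm.trans hy₀) (hx₁.symm.trans hy₁)

variable (b) in
theorem exists_mem_graph (φ ψ : G) : ∃ f f', ((f, f'), (φ, ψ)) ∈ b.graph := by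
  obtain ⟨x, hx⟩ := b.surjective (φ, ψ)
  exact ⟨x, T x, x, Prod.ext rfl hx⟩

theorem green_of_mem_graph (h : ((f, f'), (φ, ψ)) ∈ b.graph) (h' : ((g, g'), (φ', ψ')) ∈ b.graph) :
    inner ℂ g f' - inner ℂ g' f = inner ℂ φ' ψ - inner ℂ ψ' φ := by
  obtain ⟨x, rfl, rfl, rfl, rfl⟩ := mem_graph_iff.1 h
  obtain ⟨y, rfl, rfl, rfl, rfl⟩ := mem_graph_iff.1 h'
  exact b.green x y

theorem mem_graph_iff_green : ((f, f'), (φ, ψ)) ∈ b.graph ↔ (f, f') ∈ T.graph ∧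
    ∀ r ∈ b.graph, inner ℂ r.1.1 f' - inner ℂ r.1.2 f = inner ℂ r.2.1 ψ - inner ℂ r.2.2 φ := by
  constructor
  · intro h
    obtain ⟨x, rfl, rfl, -, -⟩ := mem_graph_iff.1 h
    exact ⟨T.mem_graph x, fun r hr => green_of_mem_graph h hr⟩
  · rintro ⟨hT, hgreen⟩
    obtain ⟨x, rfl, rfl⟩ := (LinearPMap.mem_graph_iff T).1 hT
    have hboundary (φ' ψ') : inner ℂ φ' ψ - inner ℂ ψ' φ =
        inner ℂ φ' (b.Γ₁ x) - inner ℂ ψ' (b.Γ₀ x) := by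
      obtain ⟨g, g', hg⟩ := b.exists_mem_graph φ' ψ'
      rw [← hgreen _ hg, green_of_mem_graph (mem_graph x) hg]
    have hφ : b.Γ₀ x = φ := ext_inner_left ℂ fun ψ' => by
      simpa only [inner_zero_left, zero_sub, neg_inj] using (hboundary 0 ψ').symm
    have hψ : b.Γ₁ x = ψ := ext_inner_left ℂ fun φ' => by
      simpa only [inner_zero_left, sub_zero] using (hboundary φ' 0).symm
    exact mem_graph_iff.2 ⟨x, rfl, rfl, hφ, hψ⟩

variable (b) in
theorem isClosed_graph (hT : T.IsClosed) : IsClosed (b.graph : Set ((H × H) × (G × G))) := by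
  have hgraph : (b.graph : Set ((H × H) × (G × G))) = Prod.fst ⁻¹' T.graph ∩
      ⋂ r ∈ b.graph, {q | inner ℂ r.1.1 q.1.2 - inner ℂ r.1.2 q.1.1 =
        inner ℂ r.2.1 q.2.2 - inner ℂ r.2.2 q.2.1} := by
    ext ⟨⟨f, f'⟩, φ, ψ⟩
    simp only [Set.mem_inter_iff, Set.mem_iInter]
    exact mem_graph_iff_green
  rw [hgraph]
  exact (hT.preimage continuous_fst).inter
    (isClosed_biInter fun r _ => isClosed_eq (by fun_prop) (by fun_prop))

theorem extZero_le : b.extZero ≤ T := T.domRestrict_le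

theorem ext_le : b.ext Θ ≤ T := T.domRestrict_le

theorem mem_graph_extZero : (f, f') ∈ b.extZero.graph ↔ ∃ ψ, ((f, f'), (0, ψ)) ∈ b.graph := by
  simp only [extZero, mem_graph_restrictTo, mem_graph_iff, LinearMap.mem_ker]
  exact ⟨fun ⟨x, h₀, h, h'⟩ => ⟨_, x, h, h', h₀, rfl⟩, fun ⟨_, x, h, h', h₀, _⟩ => ⟨x, h₀, h, h'⟩⟩

theorem mem_graph_ext : (f, f') ∈ (b.ext Θ).graph ↔
    ∃ φ ψ, ((f, f'), (φ, ψ)) ∈ b.graph ∧ (φ, ψ) ∈ Θ.graph := by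
  simp only [ext, mem_graph_restrictTo, mem_graph_iff]
  constructor
  · rintro ⟨x, hx, rfl, rfl⟩
    exact ⟨_, _, ⟨x, rfl, rfl, rfl, rfl⟩, hx⟩
  · rintro ⟨_, _, ⟨x, rfl, rfl, rfl, rfl⟩, hx⟩
    exact ⟨x, hx, rfl, rfl⟩

theorem eq_of_mem_graph_smul (hz : z ∈ resolventSet b.extZero)
    (h : ((f, z • f), (φ, ψ)) ∈ b.graph) (h' : ((g, z • g), (φ, ψ')) ∈ b.graph) :
    f = g ∧ ψ = ψ' := by
  have hsub : ((f - g, z • (f - g)), (0, ψ - ψ')) ∈ b.graph := by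
    simpa only [Prod.mk_sub_mk, sub_self, smul_sub] using b.graph.sub_mem h h'
  have hfg : f - g = 0 := by
    simpa only [sub_self, map_zero] using
      (resolventOp_sub_smul hz (mem_graph_extZero.2 ⟨_, hsub⟩)).symm
  obtain rfl := sub_eq_zero.1 hfg
  exact ⟨rfl, congrArg Prod.snd (boundary_eq h h')⟩

theorem exists_mem_graph_smul (hz : z ∈ resolventSet b.extZero) (φ : G) :
    ∃ f ψ, ((f, z • f), (φ, ψ)) ∈ b.graph := by
  obtain ⟨f, f', h⟩ := b.exists_mem_graph φ 0
  obtain ⟨ψ, h'⟩ := mem_graph_extZero.1 (mem_graph_resolventOp hz (f' - z • f))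
  refine ⟨f - resolventOp b.extZero z (f' - z • f), -ψ, ?_⟩
  convert b.graph.sub_mem h h' using 1
  ext <;> simp only [Prod.mk_sub_mk, sub_zero, zero_sub, smul_sub]
  abel

section Fields

variable [CompleteSpace H] [CompleteSpace G]

variable (b) in
/-- The bounded operator `(Γ₀, Γ₁) (A - z)⁻¹`, for a restriction `A` of `T` and `z ∈ ρ(A)`. -/
def resolventTrace (A : H →ₗ.[ℂ] H) (z : ℂ) : H →L[ℂ] G × G :=
  clmOfGraph (b.graph.comap (((resolventOp A z).prod
    (.id ℂ H + z • resolventOp A z)).prodMap (.id ℂ (G × G))).toLinearMap)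

variable (b) in
/-- The bounded operator `φ ↦ (γ(z) φ, M(z) φ)`, for `z ∈ ρ(A₀)`: its value at `φ` is `(f, Γ₁ f)`,
where `f` is the element of `ker (T - z)` with `Γ₀ f = φ`. -/
def gammaWeyl (z : ℂ) : G →L[ℂ] H × G :=
  clmOfGraph (b.graph.comap (((.fst ℂ H G ∘L .snd ℂ G (H × G)).prod
    (z • .fst ℂ H G ∘L .snd ℂ G (H × G))).prod
      ((ContinuousLinearMap.fst ℂ G (H × G)).prod (.snd ℂ H G ∘L .snd ℂ G (H × G)))).toLinearMap)

variable (b) in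
/-- The `γ`-field `γ(z) = (Γ₀ ↾ ker (T - z))⁻¹`. -/
def gamma (z : ℂ) : G →L[ℂ] H := .fst ℂ H G ∘L b.gammaWeyl z

variable (b) in
/-- The Weyl function `M(z)` as a bounded operator. -/
def weylOp (z : ℂ) : G →L[ℂ] G := .snd ℂ H G ∘L b.gammaWeyl z

variable (b) in
/-- `Γ₁ (A₀ - z)⁻¹`. -/
def traceOne (z : ℂ) : H →L[ℂ] G := .snd ℂ G G ∘L b.resolventTrace b.extZero z

variable (b) in
/-- `Γ₀ (B - z)⁻¹`, where `B = T ↾ ker (Γ₁ - Θ Γ₀)`. -/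
def traceZero (Θ : G →ₗ.[ℂ] G) (z : ℂ) : H →L[ℂ] G := .fst ℂ G G ∘L b.resolventTrace (b.ext Θ) z

theorem mem_graph_resolventTrace (hT : T.IsClosed) (hA : A ≤ T) (hz : z ∈ resolventSet A) (y : H) :
    ((resolventOp A z y, y + z • resolventOp A z y), b.resolventTrace A z y) ∈ b.graph := by
  refine (clmOfGraph_apply_eq_iff (x := y) (y := b.resolventTrace A z y)
    ((b.isClosed_graph hT).preimage (ContinuousLinearMap.continuous _)) fun y => ?_).1 rfl
  obtain ⟨x, hx, hx'⟩ := (LinearPMap.mem_graph_iff T).1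
    (LinearPMap.le_graph_of_le hA (mem_graph_resolventOp hz y))
  have hmem : ((resolventOp A z y, y + z • resolventOp A z y), (b.Γ₀ x, b.Γ₁ x)) ∈ b.graph :=
    mem_graph_iff.2 ⟨x, hx, hx', rfl, rfl⟩
  exact ⟨_, hmem, fun p hp => boundary_eq (f' := y + z • resolventOp A z y) hp hmem⟩

theorem mem_graph_gamma (hT : T.IsClosed) (hz : z ∈ resolventSet b.extZero) (φ : G) :
    ((b.gamma z φ, z • b.gamma z φ), (φ, b.weylOp z φ)) ∈ b.graph := by
  refine (clmOfGraph_apply_eq_iff (x := φ) (y := (b.gamma z φ, b.weylOp z φ))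
    ((b.isClosed_graph hT).preimage (ContinuousLinearMap.continuous _)) fun φ => ?_).1 rfl
  obtain ⟨f, ψ, h⟩ := exists_mem_graph_smul hz φ
  exact ⟨(f, ψ), h, fun _ h' => Prod.ext_iff.2 (eq_of_mem_graph_smul hz h' h)⟩

theorem eq_gamma_and_eq_weylOp (hT : T.IsClosed) (hz : z ∈ resolventSet b.extZero)
    (h : ((f, z • f), (φ, ψ)) ∈ b.graph) : f = b.gamma z φ ∧ ψ = b.weylOp z φ :=
  eq_of_mem_graph_smul hz h (mem_graph_gamma hT hz φ)

theorem mem_graph_traceOne (hT : T.IsClosed) (hz : z ∈ resolventSet b.extZero) (y : H) :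
    ((resolventOp b.extZero z y, y + z • resolventOp b.extZero z y), (0, b.traceOne z y)) ∈
      b.graph := by
  obtain ⟨ψ, h⟩ := mem_graph_extZero.1 (mem_graph_resolventOp hz y)
  have hψ : (0, ψ) = b.resolventTrace b.extZero z y :=
    boundary_eq h (mem_graph_resolventTrace hT extZero_le hz y)
  rwa [traceOne, ContinuousLinearMap.comp_apply, ← hψ]

theorem mem_graph_traceZero (hT : T.IsClosed) (hz : z ∈ resolventSet (b.ext Θ)) (y : H) :
    ∃ θ, ((resolventOp (b.ext Θ) z y, y + z • resolventOp (b.ext Θ) z y),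
      (b.traceZero Θ z y, θ)) ∈ b.graph ∧ (b.traceZero Θ z y, θ) ∈ Θ.graph := by
  obtain ⟨φ, θ, h, hθ⟩ := mem_graph_ext.1 (mem_graph_resolventOp hz y)
  have hφ : (φ, θ) = b.resolventTrace (b.ext Θ) z y :=
    boundary_eq h (mem_graph_resolventTrace hT ext_le hz y)
  refine ⟨θ, ?_⟩
  rw [traceZero, ContinuousLinearMap.comp_apply, ← hφ]
  exact ⟨h, hθ⟩

theorem resolventTrace_eq_comp (hT : T.IsClosed) (hA : A ≤ T) (hz : z ∈ resolventSet A)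
    (hw : w ∈ resolventSet A) : b.resolventTrace A z =
      b.resolventTrace A w ∘L (.id ℂ H + (z - w) • resolventOp A z) := by
  ext1 y
  have h := mem_graph_resolventTrace (b := b) hT hA hw (y + (z - w) • resolventOp A z y)
  rw [resolventOp_add_smul hz hw] at h
  exact boundary_eq (mem_graph_resolventTrace hT hA hz y) h

theorem gamma_eq_and_weylOp_eq (hT : T.IsClosed) (hz : z ∈ resolventSet b.extZero)
    (hw : w ∈ resolventSet b.extZero) :
    b.gamma z = (.id ℂ H + (z - w) • resolventOp b.extZero z) ∘L b.gamma w ∧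
      b.weylOp z = b.weylOp w + (z - w) • (b.traceOne z ∘L b.gamma w) := by
  have h (φ : G) := eq_gamma_and_eq_weylOp hT hz (φ := φ)
    (f := b.gamma w φ + (z - w) • resolventOp b.extZero z (b.gamma w φ))
    (ψ := b.weylOp w φ + (z - w) • b.traceOne z (b.gamma w φ)) (by
      convert b.graph.add_mem (mem_graph_gamma hT hw φ)
        (b.graph.smul_mem (z - w) (mem_graph_traceOne hT hz (b.gamma w φ))) using 1
      ext <;> simp only [Prod.mk_add_mk, Prod.smul_mk, smul_zero, add_zero]
      module)
  exact ⟨ContinuousLinearMap.ext fun φ => (h φ).1.symm,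
    ContinuousLinearMap.ext fun φ => (h φ).2.symm⟩

theorem mem_graph_weyl (hT : T.IsClosed) (hz : z ∈ resolventSet b.extZero) :
    (φ, ψ) ∈ (b.weyl z).graph ↔ b.weylOp z φ = ψ := by
  have hmem (p : G × G) : p ∈ (LinearMap.ker (T.toFun - z • T.domain.subtype)).map
      (b.Γ₀.prod b.Γ₁) ↔ b.weylOp z p.1 = p.2 := by
    constructor
    · rintro ⟨x, hx, rfl⟩
      have hTx : T x = z • (x : H) := sub_eq_zero.1 hx
      exact (eq_gamma_and_eq_weylOp hT hz (hTx ▸ mem_graph x)).2.symm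
    · intro hp
      obtain ⟨x, hx, hTx, h₀, h₁⟩ := mem_graph_iff.1 (mem_graph_gamma hT hz p.1)
      exact ⟨x, sub_eq_zero.2 (hTx.trans (hx ▸ rfl)), Prod.ext h₀ (h₁.trans hp)⟩
  rw [weyl, Submodule.toLinearPMap_graph_eq, hmem]
  intro p hp hp₀
  rw [← (hmem p).1 hp, hp₀, map_zero]

theorem weyl_domain (hT : T.IsClosed) (hz : z ∈ resolventSet b.extZero) :
    (b.weyl z).domain = ⊤ :=
  eq_top_iff.2 fun _ _ => LinearPMap.mem_domain_iff.2 ⟨_, (mem_graph_weyl hT hz).2 rfl⟩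

theorem sub_weyl_domain (hT : T.IsClosed) (hz : z ∈ resolventSet b.extZero) :
    (Θ - b.weyl z).domain = Θ.domain := by
  rw [LinearPMap.sub_domain, weyl_domain hT hz, inf_top_eq]

theorem value_sub_weyl (hT : T.IsClosed) (hz : z ∈ resolventSet b.extZero) (hφ : φ ∈ Θ.domain) :
    value (Θ - b.weyl z) φ = Θ ⟨φ, hφ⟩ - b.weylOp z φ := by
  have hsub : φ ∈ (Θ - b.weyl z).domain := by rwa [sub_weyl_domain hT hz]
  have hweyl : φ ∈ (b.weyl z).domain := by rw [weyl_domain hT hz]; trivial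
  rw [value, dif_pos hsub, (mem_graph_weyl hT hz).1 ((b.weyl z).mem_graph ⟨φ, hweyl⟩)]
  exact LinearPMap.sub_apply _ _ _

theorem mem_graph_sub_weyl (hT : T.IsClosed) (hz : z ∈ resolventSet b.extZero) :
    (φ, ψ) ∈ (Θ - b.weyl z).graph ↔ (φ, ψ + b.weylOp z φ) ∈ Θ.graph := by
  have hvalue {x} (hx : x ∈ (Θ - b.weyl z).domain) (hx' : x ∈ Θ.domain) :
      (Θ - b.weyl z) ⟨x, hx⟩ = Θ ⟨x, hx'⟩ - b.weylOp z x := by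
    rw [← value_sub_weyl hT hz hx', value, dif_pos hx]
  simp only [LinearPMap.mem_graph_iff]
  constructor
  · rintro ⟨⟨x, hx⟩, rfl, rfl⟩
    have hx' : x ∈ Θ.domain := by rwa [sub_weyl_domain hT hz] at hx
    exact ⟨⟨x, hx'⟩, rfl, by rw [hvalue hx hx', sub_add_cancel]⟩
  · rintro ⟨⟨x, hx'⟩, rfl, hψ⟩
    have hx : x ∈ (Θ - b.weyl z).domain := by rwa [sub_weyl_domain hT hz]
    exact ⟨⟨x, hx⟩, rfl, by rw [hvalue hx hx', hψ, add_sub_cancel_right]⟩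

theorem mem_graph_sub_weyl_and_resolventOp_sub (hT : T.IsClosed) (hz : z ∈ resolventSet b.extZero)
    (hz' : z ∈ resolventSet (b.ext Θ)) (y : H) :
    (b.traceZero Θ z y, b.traceOne z y) ∈ (Θ - b.weyl z).graph ∧
      resolventOp (b.ext Θ) z y - resolventOp b.extZero z y = b.gamma z (b.traceZero Θ z y) := by
  obtain ⟨θ, h, hθ⟩ := mem_graph_traceZero hT hz' y
  have hsub := b.graph.sub_mem h (mem_graph_traceOne hT hz y)
  simp only [Prod.mk_sub_mk, sub_zero, add_sub_add_left_eq_sub, ← smul_sub] at hsub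
  obtain ⟨hgamma, hweyl⟩ := eq_gamma_and_eq_weylOp hT hz hsub
  rw [mem_graph_sub_weyl hT hz, ← hweyl, add_sub_cancel]
  exact ⟨hθ, hgamma⟩

theorem traceOne_surjective (hT : T.IsClosed) (hz : z ∈ resolventSet b.extZero) :
    Function.Surjective (b.traceOne z) := by
  intro ψ
  obtain ⟨f, f', h⟩ := b.exists_mem_graph 0 ψ
  have hmem := mem_graph_traceOne hT hz (f' - z • f)
  rw [resolventOp_sub_smul hz (mem_graph_extZero.2 ⟨_, h⟩)] at hmem
  exact ⟨f' - z • f, congrArg Prod.snd (boundary_eq hmem h)⟩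

theorem eq_zero_of_mem_graph_sub_weyl (hT : T.IsClosed) (hz : z ∈ resolventSet b.extZero)
    (hz' : z ∈ resolventSet (b.ext Θ)) (h : (φ, 0) ∈ (Θ - b.weyl z).graph) : φ = 0 := by
  rw [mem_graph_sub_weyl hT hz, zero_add] at h
  have hφ := mem_graph_gamma hT hz φ
  have hgamma : b.gamma z φ = 0 := by
    simpa only [sub_self, map_zero] using
      (resolventOp_sub_smul hz' (mem_graph_ext.2 ⟨_, _, hφ, h⟩)).symm
  rw [hgamma] at hφ
  exact congrArg Prod.fst (boundary_eq hφ b.graph.zero_mem)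

theorem mem_graph_sub_weyl_traceOne_iff (hT : T.IsClosed) (hz : z ∈ resolventSet b.extZero)
    (hz' : z ∈ resolventSet (b.ext Θ)) (y : H) :
    (φ, b.traceOne z y) ∈ (Θ - b.weyl z).graph ↔ b.traceZero Θ z y = φ := by
  have hy := (mem_graph_sub_weyl_and_resolventOp_sub hT hz hz' y).1
  refine ⟨fun hφ => sub_eq_zero.1 (eq_zero_of_mem_graph_sub_weyl hT hz hz' ?_), fun h => h ▸ hy⟩
  simpa only [Prod.mk_sub_mk, sub_self] using (Θ - b.weyl z).graph.sub_mem hy hφ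

theorem isClosed_sub_weyl (hT : T.IsClosed) (hz : z ∈ resolventSet b.extZero)
    (hz' : z ∈ resolventSet (b.ext Θ)) : (Θ - b.weyl z).IsClosed := by
  -- Closedness can be tested after pulling back along the open surjection `id × Γ₁ (A₀ - z)⁻¹`.
  have hquot := ((ContinuousLinearMap.id ℂ G).prodMap (b.traceOne z)).isQuotientMap
    (Function.surjective_id.prodMap (traceOne_surjective hT hz))
  refine hquot.isClosed_preimage.1 ?_
  have hpre : (ContinuousLinearMap.id ℂ G).prodMap (b.traceOne z) ⁻¹' (Θ - b.weyl z).graph =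
      {p | b.traceZero Θ z p.2 = p.1} :=
    Set.ext fun p => mem_graph_sub_weyl_traceOne_iff hT hz hz' p.2
  rw [hpre]
  exact isClosed_eq (by fun_prop) continuous_fst

theorem boundedlyInvertible_sub_weyl (hT : T.IsClosed) (hz : z ∈ resolventSet b.extZero)
    (hz' : z ∈ resolventSet (b.ext Θ)) : BoundedlyInvertible (Θ - b.weyl z) := by
  refine boundedlyInvertible_of_isClosed (isClosed_sub_weyl hT hz hz') fun ψ => ?_
  obtain ⟨y, rfl⟩ := traceOne_surjective hT hz ψ
  simp only [mem_graph_sub_weyl_traceOne_iff hT hz hz']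
  exact existsUnique_eq'

theorem boundedInverse_sub_weyl_traceOne (hT : T.IsClosed) (hz : z ∈ resolventSet b.extZero)
    (hz' : z ∈ resolventSet (b.ext Θ)) (y : H) :
    boundedInverse (Θ - b.weyl z) (b.traceOne z y) = b.traceZero Θ z y :=
  (boundedlyInvertible_sub_weyl hT hz hz').boundedInverse_apply_eq_iff.2
    ((mem_graph_sub_weyl_traceOne_iff hT hz hz' y).2 rfl)

theorem resolventOp_ext_sub_resolventOp_extZero (hT : T.IsClosed)
    (hz : z ∈ resolventSet b.extZero) (hz' : z ∈ resolventSet (b.ext Θ)) :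
    resolventOp (b.ext Θ) z - resolventOp b.extZero z =
      (b.gamma z ∘L boundedInverse (Θ - b.weyl z)) ∘L b.traceOne z := by
  ext y
  simp only [sub_apply, ContinuousLinearMap.comp_apply,
    boundedInverse_sub_weyl_traceOne hT hz hz']
  exact (mem_graph_sub_weyl_and_resolventOp_sub hT hz hz' y).2

theorem boundedInverse_sub_weyl_eq (hT : T.IsClosed) (hz : z ∈ resolventSet b.extZero)
    (hz' : z ∈ resolventSet (b.ext Θ)) (hw : w ∈ resolventSet b.extZero)
    (hw' : w ∈ resolventSet (b.ext Θ)) :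
    boundedInverse (Θ - b.weyl z) = (.id ℂ G + (z - w) • (b.traceZero Θ z ∘L b.gamma w)) ∘L
      boundedInverse (Θ - b.weyl w) := by
  ext ψ
  rw [(boundedlyInvertible_sub_weyl hT hz hz').boundedInverse_apply_eq_iff]
  set φ := boundedInverse (Θ - b.weyl w) ψ with hφ
  have hΘ : (φ, ψ + b.weylOp w φ) ∈ Θ.graph :=
    (mem_graph_sub_weyl hT hw).1 ((boundedlyInvertible_sub_weyl hT hw hw').mem_graph ψ)
  have hwz : (φ, ψ - (z - w) • b.traceOne z (b.gamma w φ)) ∈ (Θ - b.weyl z).graph := by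
    rw [mem_graph_sub_weyl hT hz, (gamma_eq_and_weylOp_eq hT hz hw).2]
    convert hΘ using 2
    simp only [add_apply, smul_apply, ContinuousLinearMap.comp_apply]
    abel
  convert (Θ - b.weyl z).graph.add_mem hwz ((Θ - b.weyl z).graph.smul_mem (z - w)
    ((mem_graph_sub_weyl_traceOne_iff hT hz hz' (b.gamma w φ)).2 rfl)) using 1
  simp only [Prod.smul_mk, Prod.mk_add_mk, sub_add_cancel, add_apply, smul_apply,
    ContinuousLinearMap.comp_apply, ContinuousLinearMap.id_apply, hφ]

theorem analyticAt_resolventTrace (hT : T.IsClosed) (hA : A ≤ T) (hz : z ∈ resolventSet A) :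
    AnalyticAt ℂ (b.resolventTrace A) z :=
  (analyticAt_clm_comp analyticAt_const
    (analyticAt_id_add_smul z (analyticAt_resolventOp hz))).congr
    ((isOpen_resolventSet.eventually_mem hz).mono fun _ hζ =>
      (resolventTrace_eq_comp hT hA hζ hz).symm)

theorem analyticAt_traceOne (hT : T.IsClosed) (hz : z ∈ resolventSet b.extZero) :
    AnalyticAt ℂ b.traceOne z :=
  analyticAt_clm_comp analyticAt_const (analyticAt_resolventTrace hT extZero_le hz)

theorem analyticAt_traceZero (hT : T.IsClosed) (hz : z ∈ resolventSet (b.ext Θ)) :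
    AnalyticAt ℂ (b.traceZero Θ) z :=
  analyticAt_clm_comp analyticAt_const (analyticAt_resolventTrace hT ext_le hz)

theorem analyticAt_gamma (hT : T.IsClosed) (hz : z ∈ resolventSet b.extZero) :
    AnalyticAt ℂ b.gamma z :=
  (analyticAt_clm_comp (analyticAt_id_add_smul z (analyticAt_resolventOp hz))
    analyticAt_const).congr
    ((isOpen_resolventSet.eventually_mem hz).mono fun _ hζ =>
      (gamma_eq_and_weylOp_eq hT hζ hz).1.symm)

theorem analyticAt_boundedInverse_sub_weyl (hT : T.IsClosed) (hz : z ∈ resolventSet b.extZero)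
    (hz' : z ∈ resolventSet (b.ext Θ)) :
    AnalyticAt ℂ (fun ζ => boundedInverse (Θ - b.weyl ζ)) z := by
  have hfactor := analyticAt_id_add_smul z
    (analyticAt_clm_comp (analyticAt_traceZero hT hz') (analyticAt_const (v := b.gamma z)))
  refine (analyticAt_clm_comp hfactor
    (analyticAt_const (v := boundedInverse (Θ - b.weyl z)))).congr ?_
  filter_upwards [isOpen_resolventSet.eventually_mem hz, isOpen_resolventSet.eventually_mem hz']
    with ζ hζ hζ' using (boundedInverse_sub_weyl_eq hT hζ hζ' hz hz').symm

theorem hasDerivAt_weylOp (hT : T.IsClosed) (hz : z ∈ resolventSet b.extZero) :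
    HasDerivAt b.weylOp (b.traceOne z ∘L b.gamma z) z := by
  have hcomp := (analyticAt_clm_comp (analyticAt_traceOne hT hz)
    (analyticAt_const (v := b.gamma z))).differentiableAt.hasDerivAt
  have hweyl := (((hasDerivAt_id z).sub_const z).smul hcomp).const_add (b.weylOp z)
  simp only [id_eq, sub_self, zero_smul, zero_add, one_smul] at hweyl
  exact hweyl.congr_of_eventuallyEq ((isOpen_resolventSet.eventually_mem hz).mono fun _ hζ =>
    (gamma_eq_and_weylOp_eq hT hζ hz).2)

theorem hasDerivAt_value_sub_weyl (hT : T.IsClosed) (hz : z ∈ resolventSet b.extZero)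
    (hφ : φ ∈ Θ.domain) : HasDerivAt (fun ζ => value (Θ - b.weyl ζ) φ)
      (-(b.traceOne z ∘L b.gamma z) φ) z :=
  (((hasDerivAt_weylOp hT hz).clm_apply (hasDerivAt_const z φ)).const_sub
    (Θ ⟨φ, hφ⟩)).congr_deriv (by simp only [map_zero, add_zero]) |>.congr_of_eventuallyEq
    ((isOpen_resolventSet.eventually_mem hz).mono fun _ hζ => value_sub_weyl hT hζ hφ)

theorem isDerivClosure_sub_weyl (hT : T.IsClosed) (hz : z ∈ resolventSet b.extZero) :
    IsDerivClosure (fun ζ => Θ - b.weyl ζ) z (-(b.traceOne z ∘L b.gamma z)) := by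
  intro φ hφ
  rw [sub_weyl_domain hT hz] at hφ
  exact (hasDerivAt_value_sub_weyl hT hz hφ).deriv.symm

theorem derivClosure_sub_weyl (hT : T.IsClosed) (hΘ : Dense (Θ.domain : Set G))
    (hz : z ∈ resolventSet b.extZero) :
    derivClosure (fun ζ => Θ - b.weyl ζ) z = -(b.traceOne z ∘L b.gamma z) :=
  (isDerivClosure_sub_weyl hT hz).derivClosure_eq (by rwa [sub_weyl_domain hT hz])

theorem isFinMeroAt_resolventTrace (hT : T.IsClosed) (hA : A ≤ T)
    (hz : z₀ ∈ discreteSpectrum A ∪ resolventSet A) : IsFinMeroAt (b.resolventTrace A) z₀ := by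
  have hρ := eventually_mem_resolventSet hz
  obtain ⟨w, hw⟩ := hρ.exists
  exact ((isFinMeroAt_of_analyticAt analyticAt_const).comp
    ((isFinMeroAt_resolventOp hz).id_add_smul w)).congr
    (hρ.mono fun _ hζ => (resolventTrace_eq_comp hT hA hζ hw).symm)

theorem isFinMeroAt_traceOne (hT : T.IsClosed)
    (hz : z₀ ∈ discreteSpectrum b.extZero ∪ resolventSet b.extZero) :
    IsFinMeroAt b.traceOne z₀ :=
  (isFinMeroAt_of_analyticAt analyticAt_const).comp (isFinMeroAt_resolventTrace hT extZero_le hz)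

theorem isFinMeroAt_traceZero (hT : T.IsClosed)
    (hz : z₀ ∈ discreteSpectrum (b.ext Θ) ∪ resolventSet (b.ext Θ)) :
    IsFinMeroAt (b.traceZero Θ) z₀ :=
  (isFinMeroAt_of_analyticAt analyticAt_const).comp (isFinMeroAt_resolventTrace hT ext_le hz)

theorem isFinMeroAt_gamma (hT : T.IsClosed)
    (hz : z₀ ∈ discreteSpectrum b.extZero ∪ resolventSet b.extZero) :
    IsFinMeroAt b.gamma z₀ := by
  have hρ := eventually_mem_resolventSet hz
  obtain ⟨w, hw⟩ := hρ.exists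
  exact (((isFinMeroAt_resolventOp hz).id_add_smul w).comp
    (isFinMeroAt_of_analyticAt analyticAt_const)).congr
    (hρ.mono fun _ hζ => (gamma_eq_and_weylOp_eq hT hζ hw).1.symm)

theorem isFinMeroAt_boundedInverse_sub_weyl (hT : T.IsClosed)
    (hz : z₀ ∈ discreteSpectrum b.extZero ∪ resolventSet b.extZero)
    (hz' : z₀ ∈ discreteSpectrum (b.ext Θ) ∪ resolventSet (b.ext Θ)) :
    IsFinMeroAt (fun ζ => boundedInverse (Θ - b.weyl ζ)) z₀ := by
  have hρ := (eventually_mem_resolventSet hz).and (eventually_mem_resolventSet hz')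
  obtain ⟨w, hw, hw'⟩ := hρ.exists
  have hfactor := ((isFinMeroAt_traceZero hT hz').comp
    (isFinMeroAt_of_analyticAt (analyticAt_const (v := b.gamma w)))).id_add_smul w
  refine (hfactor.comp (isFinMeroAt_of_analyticAt
    (analyticAt_const (v := boundedInverse (Θ - b.weyl w))))).congr ?_
  filter_upwards [hρ] with ζ hζ
  exact (boundedInverse_sub_weyl_eq hT hζ.1 hζ.2 hw hw').symm

theorem analyticAt_value_sub_weyl (hT : T.IsClosed) (hz : z ∈ resolventSet b.extZero)
    (hφ : φ ∈ Θ.domain) : AnalyticAt ℂ (fun ζ => value (Θ - b.weyl ζ) φ) z :=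
  Complex.analyticAt_iff_eventually_differentiableAt.2
    ((isOpen_resolventSet.eventually_mem hz).mono fun _ hζ =>
      (hasDerivAt_value_sub_weyl hT hζ hφ).differentiableAt)

theorem analyticAt_derivClosure_sub_weyl (hT : T.IsClosed) (hΘ : Dense (Θ.domain : Set G))
    (hz : z ∈ resolventSet b.extZero) :
    AnalyticAt ℂ (derivClosure fun ζ => Θ - b.weyl ζ) z :=
  (analyticAt_clm_comp (analyticAt_traceOne hT hz) (analyticAt_gamma hT hz)).neg.congr
    ((isOpen_resolventSet.eventually_mem hz).mono fun _ hζ =>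
      (derivClosure_sub_weyl hT hΘ hζ).symm)

theorem isFinMeroAt_derivClosure_sub_weyl (hT : T.IsClosed) (hΘ : Dense (Θ.domain : Set G))
    (hz : z₀ ∈ discreteSpectrum b.extZero ∪ resolventSet b.extZero) :
    IsFinMeroAt (derivClosure fun ζ => Θ - b.weyl ζ) z₀ :=
  ((isFinMeroAt_traceOne hT hz).comp (isFinMeroAt_gamma hT hz)).neg.congr
    ((eventually_mem_resolventSet hz).mono fun _ hζ => (derivClosure_sub_weyl hT hΘ hζ).symm)

theorem indexHypothesis_sub_weyl (hT : T.IsClosed) (hΘ : Dense (Θ.domain : Set G)) (hε : 0 < ε)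
    (hρ : Metric.ball z₀ ε \ {z₀} ⊆ resolventSet b.extZero ∩ resolventSet (b.ext Θ))
    (hz : z₀ ∈ discreteSpectrum b.extZero ∪ resolventSet b.extZero)
    (hz' : z₀ ∈ discreteSpectrum (b.ext Θ) ∪ resolventSet (b.ext Θ)) :
    IndexHypothesis (Metric.ball z₀ ε) {z₀} (fun ζ => Θ - b.weyl ζ) := by
  have hdomain {ζ} (hζ : ζ ∈ Metric.ball z₀ ε \ {z₀}) : (Θ - b.weyl ζ).domain = Θ.domain :=
    sub_weyl_domain hT (hρ hζ).1
  have hinv : AnalyticOnNhd ℂ (fun ζ => boundedInverse (Θ - b.weyl ζ))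
      (Metric.ball z₀ ε \ {z₀}) := fun ζ hζ =>
    analyticAt_boundedInverse_sub_weyl hT (hρ hζ).1 (hρ hζ).2
  have hderiv : AnalyticOnNhd ℂ (derivClosure fun ζ => Θ - b.weyl ζ)
      (Metric.ball z₀ ε \ {z₀}) := fun ζ hζ => analyticAt_derivClosure_sub_weyl hT hΘ (hρ hζ).1
  exact
    { isOpen := Metric.isOpen_ball
      isConnected := Metric.isConnected_ball hε
      subset := Set.singleton_subset_iff.2 (Metric.mem_ball_self hε)
      discrete := fun _ _ h => Set.Infinite.of_accPt h (Set.finite_singleton z₀)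
      closed := fun _ hζ => isClosed_sub_weyl hT (hρ hζ).1 (hρ hζ).2
      dense := fun _ hζ => by rwa [hdomain hζ]
      domain_eq := fun _ hζ _ hξ => (hdomain hζ).trans (hdomain hξ).symm
      invertible := fun _ hζ => boundedlyInvertible_sub_weyl hT (hρ hζ).1 (hρ hζ).2
      inv_analytic := hinv
      inv_finMero :=
        finitelyMeromorphicOn_of_analyticOnNhd hinv (isFinMeroAt_boundedInverse_sub_weyl hT hz hz')
      analytic := fun _ hφ ζ hζ =>
        analyticAt_value_sub_weyl hT (hρ hζ).1 (hdomain hζ ▸ hφ ζ hζ)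
      deriv_bounded := fun _ hζ => ⟨_, isDerivClosure_sub_weyl hT (hρ hζ).1⟩
      deriv_analytic := hderiv
      deriv_finMero :=
        finitelyMeromorphicOn_of_analyticOnNhd hderiv (isFinMeroAt_derivClosure_sub_weyl hT hΘ hz) }

theorem indexOperator_sub_weyl (hT : T.IsClosed) (hΘ : Dense (Θ.domain : Set G)) (hr : 0 ≤ r)
    (hρ : Metric.sphere z₀ r ⊆ resolventSet b.extZero) :
    indexOperator (fun ζ => Θ - b.weyl ζ) z₀ r = -residueIntegral
      (fun ζ => b.traceOne ζ ∘L b.gamma ζ ∘L boundedInverse (Θ - b.weyl ζ)) z₀ r := by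
  rw [← residueIntegral_neg]
  refine residueIntegral_congr hr fun ζ hζ => ?_
  simp only [derivClosure_sub_weyl hT hΘ (hρ hζ)]
  rfl

theorem residueIntegral_gamma_comp_traceOne (hT : T.IsClosed) (hr : 0 ≤ r)
    (hρ : Metric.sphere z₀ r ⊆ resolventSet b.extZero ∩ resolventSet (b.ext Θ)) :
    residueIntegral (fun ζ => (b.gamma ζ ∘L boundedInverse (Θ - b.weyl ζ)) ∘L b.traceOne ζ) z₀ r =
      residueIntegral (resolventOp (b.ext Θ)) z₀ r -
        residueIntegral (resolventOp b.extZero) z₀ r := by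
  rw [← residueIntegral_sub (circleIntegrable_resolventOp hr fun _ hζ => (hρ hζ).2)
    (circleIntegrable_resolventOp hr fun _ hζ => (hρ hζ).1)]
  exact residueIntegral_congr hr fun ζ hζ =>
    (resolventOp_ext_sub_resolventOp_extZero hT (hρ hζ).1 (hρ hζ).2).symm

theorem indexOperator_sub_weyl_eq (hT : T.IsClosed) (hΘ : Dense (Θ.domain : Set G))
    (hρ : Metric.ball z₀ ε \ {z₀} ⊆ resolventSet b.extZero ∩ resolventSet (b.ext Θ))
    (hr : r ∈ Set.Ioo 0 ε) (hs : s ∈ Set.Ioo 0 ε) :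
    indexOperator (fun ζ => Θ - b.weyl ζ) z₀ r = indexOperator (fun ζ => Θ - b.weyl ζ) z₀ s :=
  residueIntegral_eq_of_differentiableOn (fun _ hζ =>
    (analyticAt_clm_comp (analyticAt_derivClosure_sub_weyl hT hΘ (hρ hζ).1)
      (analyticAt_boundedInverse_sub_weyl hT (hρ hζ).1
        (hρ hζ).2)).differentiableAt.differentiableWithinAt) hr hs

theorem eventually_generalizedIndex_sub_weyl (hT : T.IsClosed) (hΘ : Dense (Θ.domain : Set G))
    (hz : z₀ ∈ discreteSpectrum b.extZero ∪ resolventSet b.extZero)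
    (hz' : z₀ ∈ discreteSpectrum (b.ext Θ) ∪ resolventSet (b.ext Θ)) :
    ∀ᶠ r in 𝓝[>] (0 : ℝ), FiniteRank (indexOperator (fun ζ => Θ - b.weyl ζ) z₀ r) ∧
      generalizedIndex (fun ζ => Θ - b.weyl ζ) z₀ r =
        (algMult (b.ext Θ) z₀ : ℂ) - (algMult b.extZero z₀ : ℂ) := by
  have hcomm := (isFinMeroAt_traceOne hT hz).eventually_residueTraceComm
    ((isFinMeroAt_gamma hT hz).comp (isFinMeroAt_boundedInverse_sub_weyl hT hz hz'))
  have hsphere := eventually_sphere_subset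
    ((eventually_mem_resolventSet hz).and (eventually_mem_resolventSet hz'))
  filter_upwards [self_mem_nhdsWithin, hsphere, hcomm,
    eventually_finiteRankTrace_residueIntegral_resolventOp hz,
    eventually_finiteRankTrace_residueIntegral_resolventOp hz']
    with r (hr : 0 < r) hρ ⟨hfin, _, htrace⟩ ⟨hfinA, htraceA⟩ ⟨hfinB, htraceB⟩
  rw [residueIntegral_gamma_comp_traceOne hT hr.le hρ, sub_eq_add_neg,
    finiteRankTrace_add hfinB hfinA.neg, finiteRankTrace_neg hfinA, htraceA, htraceB] at htrace
  rw [generalizedIndex, indexOperator_sub_weyl hT hΘ hr.le fun _ hζ => (hρ hζ).1]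
  refine ⟨hfin.neg, ?_⟩
  rw [finiteRankTrace_neg hfin, htrace]
  ring

end Fields

end BoundaryTriple

end BoundaryTriples

end GenIndex

end

theorem corollary4p4_general
    {H : Type*} [NormedAddCommGroup H] [InnerProductSpace ℂ H] [CompleteSpace H]
    {G : Type*} [NormedAddCommGroup G] [InnerProductSpace ℂ G] [CompleteSpace G]
    {T : H →ₗ.[ℂ] H} (hT : T.IsClosed) (b : GenIndex.BoundaryTriple T G)
    (Θ : G →ₗ.[ℂ] G) (hΘ : Dense (Θ.domain : Set G)) (z₀ : ℂ)
    (hB : z₀ ∈ GenIndex.discreteSpectrum (b.ext Θ) ∪ GenIndex.resolventSet (b.ext Θ))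
    (hA : z₀ ∈ GenIndex.discreteSpectrum b.extZero ∪ GenIndex.resolventSet b.extZero) :
    ∃ ε₀ > 0,
      GenIndex.IndexHypothesis (Metric.ball z₀ ε₀) {z₀} (fun z => Θ - b.weyl z) ∧
      ∀ ε, 0 < ε → ε < ε₀ →
        GenIndex.FiniteRank (GenIndex.indexOperator (fun z => Θ - b.weyl z) z₀ ε) ∧
        GenIndex.generalizedIndex (fun z => Θ - b.weyl z) z₀ ε =
          (GenIndex.algMult (b.ext Θ) z₀ : ℂ) - (GenIndex.algMult b.extZero z₀ : ℂ) := by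
  obtain ⟨ε₀, hε₀, hρ⟩ := Metric.mem_nhdsWithin_iff.1
    ((GenIndex.eventually_mem_resolventSet hA).and (GenIndex.eventually_mem_resolventSet hB))
  refine ⟨ε₀, hε₀, b.indexHypothesis_sub_weyl hT hΘ hε₀ hρ hA hB, fun ε hε hεε₀ => ?_⟩
  obtain ⟨r, hindex, hr⟩ := ((b.eventually_generalizedIndex_sub_weyl hT hΘ hA hB).and
    (Ioo_mem_nhdsGT hε₀)).exists
  rw [GenIndex.generalizedIndex, b.indexOperator_sub_weyl_eq hT hΘ hρ ⟨hε, hεε₀⟩ hr]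
  exact hindex

theorem corollary4p4
    {H : Type*} [NormedAddCommGroup H] [InnerProductSpace ℂ H] [CompleteSpace H]
    [TopologicalSpace.SeparableSpace H]
    {G : Type*} [NormedAddCommGroup G] [InnerProductSpace ℂ G] [CompleteSpace G]
    (A₀ B₂ S : H →ₗ.[ℂ] H)
    (hA₀ : IsSelfAdjoint A₀) (hB₂ : B₂.IsClosed)
    (hS : S = A₀ ⊓ B₂) (hSdense : Dense (S.domain : Set H))
    (hS' : S = A₀ ⊓ B₂.adjoint)
    (b : GenIndex.BoundaryTriple S.adjoint G)
    (Θ₂ : G →ₗ.[ℂ] G) (hΘclosed : Θ₂.IsClosed) (hΘdense : Dense (Θ₂.domain : Set G))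
    (hbA₀ : A₀ = b.extZero) (hbB₂ : B₂ = b.ext Θ₂)
    (z₀ : ℂ)
    (hzB₂ : z₀ ∈ GenIndex.discreteSpectrum B₂ ∪ GenIndex.resolventSet B₂)
    (hzA₀ : z₀ ∈ GenIndex.discreteSpectrum A₀ ∪ GenIndex.resolventSet A₀) :
    ∃ ε₀ > 0,
      GenIndex.IndexHypothesis (Metric.ball z₀ ε₀) {z₀} (fun z => Θ₂ - b.weyl z) ∧
      ∀ ε, 0 < ε → ε < ε₀ →
        GenIndex.FiniteRank (GenIndex.indexOperator (fun z => Θ₂ - b.weyl z) z₀ ε) ∧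
        GenIndex.generalizedIndex (fun z => Θ₂ - b.weyl z) z₀ ε =
          (GenIndex.algMult B₂ z₀ : ℂ) - (GenIndex.algMult A₀ z₀ : ℂ) := by
  subst hbA₀ hbB₂
  exact corollary4p4_general (LinearPMap.adjoint_isClosed hSdense) b Θ₂ hΘdense z₀ hzB₂ hzA₀
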